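/- **Model.** Fix rates $\mu,\gamma>0$, a variance proxy $\sigma^2>0$, a constant $\alpha\in(0,1)$ and grids $0=t_0<\dots<t_m$ and $0=b_0<\dots<b_{m'}=1$. An *environment* is a triple $E=(k,q,\nu)$ such that: - $k:[0,\infty)\to[0,1]$ is nondecreasing, concave and piecewise linear with breakpoints among the $t_i$, and constant on $[t_m,\infty)$; - $q$ is the cumulative distribution function of a probability law on $[0,1]$, with $q(0)=0$, $q(1)=1$, and $q$ is linear with positive slope on each $[b_{i-1},b_i]$; moreover $q(v)>\alpha v$ for all $0<v\le k(t_m)$; - $\nu$ is a centred law on $\mathbb R$ that is sub-Gaussian with variance proxy $\sigma^2$. An *episode* lasts an exponential time $T$ of rate $\gamma$. During $[0,T]$, auctions arrive at the times $s_1<\dots<s_\ell$ of an independent Poisson process of intensity $\mu$. The prices to beat $b_i^-$ are i.i.d. with distribution function $q$, the noises $\varepsilon_i$ are i.i.d. with law $\nu$, and all of these are independent. A *policy* is a measurable function $\pi:[0,\infty)\to[0,\infty)$. In auction $i$ it bids $\pi(s_i-S_{i-1})$, where $S_{i-1}$ is the time of the last auction won before auction $i$ in the episode ($0$ if there is none),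 and it wins if and only if $\pi(s_i-S_{i-1})>b_i^-$. The payoff of the episode is $$\sum_{i=1}^{\ell}\bigl(k(s_i-S_{i-1})+\varepsilon_i-b_i^-\bigr)\,\mathbb I[\pi(s_i-S_{i-1})>b_i^-],$$ $V_\pi(0)$ denotes its expectation, and $V^\star(0)=\sup_\pi V_\pi(0)$. After an episode the learner observes $T$, the number of auctions $\ell$, for each auction its time, whether it was won and, if so, the price paid, and the total payoff of the episode (not the individual rewards). A *learning algorithm* does not know $E$. It chooses the policy $\pi_n$ of episode $n$ as a measurable function of the observations from episodes $1,\dots,n-1$ and, possibly, of an independent random seed. Episodes are independent. In environment $E$ its expected regret over $N$ episodes is $$\mathrm{Regret}_E(N)=\mathbb E\Bigl[\sum_{n=1}^N\bigl(V^\star(0)-V_{\pi_n}(0)\bigr)\Bigr].$$ **Theorem (logarithmic lower bound on the minimax regret).** There is a constant $C>0$, depending only on $\mu,\gamma,\sigma^2,\alpha$ and the grids, such that for every learning algorithm and every horizon $N\ge1$ there is an environment $E$ in the class above with $$\mathrm{Regret}_E(N)\ \ge\ C\log N .$$ -/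

import Mathlib

open MeasureTheory ProbabilityTheory
open scoped NNReal

namespace DynamicBidding

/-- `k` is concave, nondecreasing and piecewise linear on `[0, ∞)`, with breakpoints among
`0 = t 0 < t 1 < ⋯ < t m`: it has nonnegative nonincreasing slopes `a i` on `[t i, t (i+1)]` and
it is constant on `[t m, ∞)`. -/
def IsConcavePiecewiseLinear {m : ℕ} (t : Fin (m + 1) → ℝ) (k : ℝ → ℝ) : Prop :=
  ∃ a : Fin m → ℝ, Antitone a ∧ (∀ i, 0 ≤ a i) ∧
    ∀ τ, 0 ≤ τ → k τ = k 0 + ∑ i : Fin m, a i * (min (t i.succ) τ - min (t i.castSucc) τ)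

/-- `q` is piecewise linear on `[0, 1]` with breakpoints `0 = b 0 < b 1 < ⋯ < b m = 1`, with
`q 0 = 0` and positive slopes `c i` on `[b i, b (i+1)]`. -/
def IsIncreasingPiecewiseLinear {m : ℕ} (b : Fin (m + 1) → ℝ) (q : ℝ → ℝ) : Prop :=
  ∃ c : Fin m → ℝ, (∀ i, 0 < c i) ∧
    ∀ v, 0 ≤ v → v ≤ 1 → q v = ∑ i : Fin m, c i * (min (b i.succ) v - min (b i.castSucc) v)

/-- The unknown environment: the mean reward `k τ` of a win when a time `τ` has elapsed since the
last win, the law of the price to beat (its cumulative distribution function is `q`), and the law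
of the reward noise. -/
structure Environment where
  k : ℝ → ℝ
  priceLaw : Measure ℝ
  noiseLaw : Measure ℝ
  [isProbabilityMeasure_priceLaw : IsProbabilityMeasure priceLaw]
  [isProbabilityMeasure_noiseLaw : IsProbabilityMeasure noiseLaw]

/-- The class of environments: `k` and `q` are piecewise linear on the given grids, `k` takes its
values in `[0, 1]`, prices lie in `[0, 1]` (`q 1 = 1`), `q v > α v` for `0 < v ≤ k (t m)`, and the
noise is centred and sub-Gaussian with variance proxy `σsq`. -/
structure Environment.IsAdmissible {mk mq : ℕ} (t : Fin (mk + 1) → ℝ) (b : Fin (mq + 1) → ℝ)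
    (α : ℝ) (σsq : ℝ≥0) (E : Environment) : Prop where
  k_piecewise : IsConcavePiecewiseLinear t E.k
  k_nonneg : ∀ τ, 0 ≤ τ → 0 ≤ E.k τ
  k_le_one : ∀ τ, 0 ≤ τ → E.k τ ≤ 1
  q_piecewise : IsIncreasingPiecewiseLinear b (cdf E.priceLaw)
  q_one : cdf E.priceLaw 1 = 1
  q_gt : ∀ v, 0 < v → v ≤ E.k (t (Fin.last mk)) → α * v < cdf E.priceLaw v
  noise_mean : ∫ x, x ∂E.noiseLaw = 0
  noise_subgaussian : HasSubgaussianMGF (fun x : ℝ => x) σsq E.noiseLaw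

/-- The primitive randomness of one episode: its length, the interarrival times of the auction
requests, the prices to beat, and the reward noises. -/
abbrev Sample : Type := ℝ × (ℕ → ℝ) × (ℕ → ℝ) × (ℕ → ℝ)

namespace Sample

/-- The length of the episode. -/
def length (s : Sample) : ℝ := s.1

/-- The arrival time of auction `i` (auctions are numbered from `0`). -/
def arrival (s : Sample) (i : ℕ) : ℝ := ∑ j ∈ Finset.range (i + 1), s.2.1 j

/-- The price to beat in auction `i`. -/
def price (s : Sample) (i : ℕ) : ℝ := s.2.2.1 i

/-- The reward noise of auction `i`. -/
def noise (s : Sample) (i : ℕ) : ℝ := s.2.2.2 i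

/-- The number of auctions in the episode: the index of the first request that arrives after the
end of the episode. -/
noncomputable def numAuctions (s : Sample) : ℕ := sInf {i | s.length < s.arrival i}

end Sample

/-- The law of the randomness of one episode: an exponential length of rate `γ`, independent
exponential interarrival times of rate `μ` (a Poisson process of intensity `μ`), i.i.d. prices and
i.i.d. noises, all independent. -/
noncomputable def episodeLaw (μ γ : ℝ) (E : Environment) : Measure Sample :=
  (expMeasure γ).prod
    ((Measure.infinitePi fun _ : ℕ => expMeasure μ).prod
      ((Measure.infinitePi fun _ : ℕ => E.priceLaw).prod
        (Measure.infinitePi fun _ : ℕ => E.noiseLaw)))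

/-- A bidding policy gives the bid as a function of the time elapsed since the last win. -/
abbrev Policy : Type := ℝ → ℝ≥0

/-- The time of the last win before auction `i` under the policy `π` (`0` if there is none). -/
noncomputable def lastWin (π : Policy) (s : Sample) : ℕ → ℝ
  | 0 => 0
  | i + 1 =>
      if s.price i < π (s.arrival i - lastWin π s i) then s.arrival i else lastWin π s i

/-- The time elapsed since the last win, at auction `i`. -/
noncomputable def age (π : Policy) (s : Sample) (i : ℕ) : ℝ := s.arrival i - lastWin π s i

/-- Auction `i` is won: the bid exceeds the price to beat. -/
def Wins (π : Policy) (s : Sample) (i : ℕ) : Prop := s.price i < π (age π s i)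

open Classical in
/-- The total payoff of an episode: over the auctions won, the sum of the realised reward minus
the price. -/
noncomputable def payoff (E : Environment) (π : Policy) (s : Sample) : ℝ :=
  ∑ i ∈ Finset.range s.numAuctions,
    if Wins π s i then E.k (age π s i) + s.noise i - s.price i else 0

/-- The expected payoff `V_π(0)` of a policy. -/
noncomputable def value (μ γ : ℝ) (E : Environment) (π : Policy) : ℝ :=
  ∫ s, payoff E π s ∂(episodeLaw μ γ E)

/-- The optimal value `V^⋆(0)`: the supremum of `V_π(0)` over the measurable policies. -/
noncomputable def optimalValue (μ γ : ℝ) (E : Environment) : ℝ :=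
  ⨆ π : {π : Policy // Measurable π}, value μ γ E π.1

/-- What is observed at the end of an episode: its length, the number of auctions, for each
auction its time, whether it was won and the price paid, and the total payoff of the episode. The
per-auction sequence is padded with zeros. -/
abbrev Record : Type := ℝ × ℕ × (ℕ → ℝ × Bool × ℝ) × ℝ

open Classical in
/-- The record of an episode played with policy `π`. The price paid is `0` for a lost auction.
The individual rewards are not observed, only the total payoff. -/
noncomputable def record (E : Environment) (π : Policy) (s : Sample) : Record :=
  (s.length, s.numAuctions,
    fun i =>
      if i < s.numAuctions then
        (s.arrival i, decide (Wins π s i), if Wins π s i then s.price i else 0)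
      else (0, false, 0),
    payoff E π s)

/-- A learning algorithm, possibly randomized through a random seed: it chooses the policy of
episode `n` from the seed and from the records of the episodes before `n`. -/
structure Algorithm (Seed : Type*) [MeasurableSpace Seed] where
  policy : (n : ℕ) → Seed → (Fin n → Record) → Policy
  measurable_policy : ∀ n, Measurable fun x : (Seed × (Fin n → Record)) × ℝ =>
    policy n x.1.1 x.1.2 x.2

namespace Algorithm

variable {Seed : Type*} [MeasurableSpace Seed]

/-- The records of the first `n` episodes when the algorithm is run in the environment `E`. -/
noncomputable def history (A : Algorithm Seed) (E : Environment) (u : Seed) (ω : ℕ → Sample) :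
    (n : ℕ) → Fin n → Record
  | 0 => Fin.elim0
  | n + 1 => Fin.snoc (α := fun _ => Record) (history A E u ω n)
      (record E (A.policy n u (history A E u ω n)) (ω n))

/-- The policy played in episode `n`. -/
noncomputable def played (A : Algorithm Seed) (E : Environment) (u : Seed) (ω : ℕ → Sample)
    (n : ℕ) : Policy :=
  A.policy n u (A.history E u ω n)

/-- The regret over `N` episodes along a realisation of the seed and of the episodes. -/
noncomputable def regret (A : Algorithm Seed) (μ γ : ℝ) (E : Environment) (N : ℕ)
    (x : Seed × (ℕ → Sample)) : ℝ :=
  ∑ n ∈ Finset.range N, (optimalValue μ γ E - value μ γ E (A.played E x.1 x.2 n))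

/-- The expected regret over `N` independent episodes; the seed has law `ρ` and is independent of
the episodes. -/
noncomputable def expectedRegret (A : Algorithm Seed) (ρ : Measure Seed) (μ γ : ℝ)
    (E : Environment) (N : ℕ) : ℝ :=
  ∫ x, A.regret μ γ E N x ∂(ρ.prod (Measure.infinitePi fun _ : ℕ => episodeLaw μ γ E))

end Algorithm

end DynamicBidding

/-! Restrict to environments with a constant mean reward κ, uniform prices and Gaussian noise of
variance σ². A bid `p` then earns on average κ²/2 − (min(p, 1) − κ)²/2, so always bidding κ is
optimal, and the regret of a policy over an episode is half the expected sum, over the auctions, of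
the squared distances from its truncated bids to κ (`hasSum_value_sub`). Bidding well amounts to
estimating κ under squared loss.

Arrivals and prices alone decide which auctions a given policy wins. Hence replacing κ by κ + δ only
moves the total payoff, by δ times the number of wins, which has the effect of translating one
Gaussian variable by at most |δ| times the number of auctions. That number has a finite second
moment M, so the affinity (Bhattacharyya coefficient) of the two laws of a record is at least 1 −
δ²M/(8σ²), and after n adaptive episodes the squared affinity is still at least 1/2 when nδ²M ≤ 2σ².
Densities of records are avoided by using affinity in a dual form: if `c ≤ f * g` pointwise, then
`c` times the squared affinity is at most the integral of `f` under the first law times that of `g`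
under the second. Cauchy–Schwarz makes this form stable under conditioning, so it iterates over
episodes (`history_affinity`).

No policy is good for two values of κ at once, so two values at distance of order 1/√(n+1) have
total regret at least of order 1/(n+1) in episode n (`le_episodeRegret_add`). This distance varies
with n, while one environment must serve all episodes. Therefore the regret is averaged over a fixed
fine grid of values j/J, and for each n the point j is paired with j + d, where d/J is of order
1/√(n+1) (`le_sum_episodeRegret`). Summing over n gives an average of order log N, and some grid
point does at least as badly as the average. -/

namespace DynamicBidding

open scoped ENNReal

/-! ### Cauchy–Schwarz, resampling of coordinates, and affinity of shifted Gaussians. -/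

section General

/-- Cauchy–Schwarz inequality in the form of a lower bound on a product of integrals. -/
theorem sq_lintegral_le_mul_lintegral {X : Type*} [MeasurableSpace X] (ν : Measure X)
    {f g w : X → ℝ≥0∞} (hf : Measurable f) (hg : Measurable g)
    (h : ∀ x, w x ^ 2 ≤ f x * g x) :
    (∫⁻ x, w x ∂ν) ^ 2 ≤ (∫⁻ x, f x ∂ν) * ∫⁻ x, g x ∂ν := by
  have hpow : ∀ a : ℝ≥0∞, (a ^ (1 / 2 : ℝ)) ^ (2 : ℝ) = a := fun a => by
    rw [← ENNReal.rpow_mul]; norm_num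
  have key := ENNReal.lintegral_mul_le_Lp_mul_Lq ν Real.HolderConjugate.two_two
    (hf.pow_const (1 / 2 : ℝ)).aemeasurable (hg.pow_const (1 / 2 : ℝ)).aemeasurable
  simp only [hpow, Pi.mul_apply] at key
  have hw : ∀ x, w x ≤ f x ^ (1 / 2 : ℝ) * g x ^ (1 / 2 : ℝ) := fun x => by
    rw [← ENNReal.mul_rpow_of_nonneg _ _ (by norm_num : (0 : ℝ) ≤ 1 / 2)]
    have := ENNReal.rpow_le_rpow (h x) (by norm_num : (0 : ℝ) ≤ 1 / 2)
    rwa [← ENNReal.rpow_natCast, ← ENNReal.rpow_mul, show ((2 : ℕ) : ℝ) * (1 / 2) = 1 by norm_num,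
      ENNReal.rpow_one] at this
  calc (∫⁻ x, w x ∂ν) ^ 2
      ≤ ((∫⁻ x, f x ∂ν) ^ (1 / 2 : ℝ) * (∫⁻ x, g x ∂ν) ^ (1 / 2 : ℝ)) ^ 2 := by
        gcongr
        exact (lintegral_mono hw).trans key
    _ = _ := by
        rw [mul_pow, ← ENNReal.rpow_natCast, ← ENNReal.rpow_natCast]
        simp only [Nat.cast_ofNat, hpow]

/-- Resampling one coordinate of an i.i.d. sequence does not change its law. -/
theorem measurePreserving_update {X : Type*} [MeasurableSpace X] (ν : Measure X)
    [IsProbabilityMeasure ν] (i : ℕ) :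
    MeasurePreserving (fun x : (ℕ → X) × X => Function.update x.1 i x.2)
      ((Measure.infinitePi fun _ : ℕ => ν).prod ν) (Measure.infinitePi fun _ : ℕ => ν) := by
  have hm : Measurable (fun x : (ℕ → X) × X => Function.update x.1 i x.2) := measurable_update'
  refine ⟨hm, ?_⟩
  refine Measure.eq_infinitePi _ fun s t ht => ?_
  rw [Measure.map_apply hm (MeasurableSet.pi s.countable_toSet fun j _ => ht j)]
  have : (fun x : (ℕ → X) × X => Function.update x.1 i x.2) ⁻¹' ((s : Set ℕ).pi t)
      = (((s.erase i : Finset ℕ) : Set ℕ).pi t) ×ˢ (if i ∈ s then t i else Set.univ) := by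
    ext ⟨x, y⟩
    simp only [Set.mem_preimage, Set.mem_pi, Finset.mem_coe, Set.mem_prod, Finset.mem_erase]
    constructor
    · intro h
      refine ⟨fun j hj => ?_, ?_⟩
      · simpa [Function.update_of_ne hj.1] using h j hj.2
      · split_ifs with hi
        · simpa using h i hi
        · trivial
    · rintro ⟨h1, h2⟩ j hj
      by_cases hji : j = i
      · subst hji; simpa [hj] using h2
      · simpa [Function.update_of_ne hji] using h1 j ⟨hji, hj⟩
  rw [this, Measure.prod_prod, Measure.infinitePi_pi _ (fun j _ => ht j)]
  split_ifs with hi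
  · exact Finset.prod_erase_mul _ _ hi
  · simp [Finset.erase_eq_of_notMem hi]

theorem lintegral_infinitePi_update {X : Type*} [MeasurableSpace X] (ν : Measure X)
    [IsProbabilityMeasure ν] (i : ℕ) {f : (ℕ → X) → ℝ≥0∞} (hf : Measurable f) :
    ∫⁻ ω, f ω ∂(Measure.infinitePi fun _ : ℕ => ν)
      = ∫⁻ ω, ∫⁻ y, f (Function.update ω i y) ∂ν ∂(Measure.infinitePi fun _ : ℕ => ν) := by
  rw [← (measurePreserving_update ν i).lintegral_comp hf, lintegral_prod]
  exact (hf.comp (measurePreserving_update ν i).measurable).aemeasurable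

/-- Independence, obtained by resampling the last coordinate. It is used for the Laplace transform
of arrival times. -/
theorem lintegral_infinitePi_prod {X : Type*} [MeasurableSpace X] (ν : Measure X)
    [IsProbabilityMeasure ν] {φ : X → ℝ≥0∞} (hφ : Measurable φ) (n : ℕ) :
    ∫⁻ ω, ∏ j ∈ Finset.range n, φ (ω j) ∂(Measure.infinitePi fun _ : ℕ => ν)
      = (∫⁻ x, φ x ∂ν) ^ n := by
  induction n with
  | zero => simp
  | succ n ih =>
    rw [lintegral_infinitePi_update ν n (by fun_prop)]
    have : ∀ (ω : ℕ → X) (y : X), ∏ j ∈ Finset.range (n + 1), φ (Function.update ω n y j)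
        = (∏ j ∈ Finset.range n, φ (ω j)) * φ y := fun ω y => by
      rw [Finset.prod_range_succ, Function.update_self]
      congr 1
      refine Finset.prod_congr rfl fun j hj => ?_
      rw [Function.update_of_ne (Finset.mem_range.1 hj).ne]
    simp_rw [this]
    simp_rw [lintegral_const_mul _ hφ]
    rw [lintegral_mul_const _ (by fun_prop), ih, pow_succ]

/-- Two Gaussian laws that differ by a translation by `d` cannot be told apart well. -/
theorem gaussianReal_shift_affinity {v : ℝ≥0} (hv : v ≠ 0) (d : ℝ) {c : ℝ≥0∞}
    {F G : ℝ → ℝ≥0∞} (hF : Measurable F) (hG : Measurable G)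
    (h : ∀ y, c ≤ F y * G y) :
    c * ENNReal.ofReal (Real.exp (-(d ^ 2) / (8 * v))) ^ 2
      ≤ (∫⁻ y, F y ∂(gaussianReal 0 v)) * ∫⁻ y, G (y + d) ∂(gaussianReal 0 v) := by
  have hv' : (0 : ℝ) < v := by positivity
  have hshift : ∫⁻ y, G (y + d) ∂(gaussianReal 0 v) = ∫⁻ y, G y ∂(gaussianReal d v) := by
    rw [← lintegral_map hG (by fun_prop), gaussianReal_map_add_const, zero_add]
  rw [hshift, gaussianReal_of_var_ne_zero _ hv, gaussianReal_of_var_ne_zero _ hv,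
    lintegral_withDensity_eq_lintegral_mul _ (measurable_gaussianPDF 0 v) hF,
    lintegral_withDensity_eq_lintegral_mul _ (measurable_gaussianPDF d v) hG]
  set e := ENNReal.ofReal (Real.exp (-(d ^ 2) / (8 * v))) with he
  have hc : (c ^ (1 / 2 : ℝ)) ^ 2 = c := by
    rw [← ENNReal.rpow_natCast, ← ENNReal.rpow_mul]; norm_num
  -- The geometric mean of the densities of N(0, v) and N(d, v) is `e` times the density of N(d/2,
  -- v), by completing the square.
  have key := sq_lintegral_le_mul_lintegral (volume : Measure ℝ)
    (f := gaussianPDF 0 v * F) (g := gaussianPDF d v * G)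
    (w := fun y => (c ^ (1 / 2 : ℝ) * e) * gaussianPDF (d / 2) v y)
    ((measurable_gaussianPDF 0 v).mul hF) ((measurable_gaussianPDF d v).mul hG) ?_
  · rw [lintegral_const_mul _ (measurable_gaussianPDF _ v), lintegral_gaussianPDF_eq_one _ hv,
      mul_one, mul_pow, hc] at key
    exact key
  · intro y
    have hp : e ^ 2 * gaussianPDF (d / 2) v y ^ 2 = gaussianPDF 0 v y * gaussianPDF d v y := by
      simp only [gaussianPDF, he]
      rw [← ENNReal.ofReal_pow (by positivity), ← ENNReal.ofReal_pow (gaussianPDFReal_nonneg _ _ _),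
        ← ENNReal.ofReal_mul (by positivity), ← ENNReal.ofReal_mul (gaussianPDFReal_nonneg _ _ _)]
      congr 1
      simp only [gaussianPDFReal]
      have : ∀ a x z w u : ℝ, x * 2 + z * 2 = w + u →
          (Real.exp x) ^ 2 * (a * Real.exp z) ^ 2 = a * Real.exp w * (a * Real.exp u) := by
        intro a x z w u hh
        have h1 : Real.exp x ^ 2 * Real.exp z ^ 2 = Real.exp w * Real.exp u := by
          rw [← Real.exp_nat_mul, ← Real.exp_nat_mul, ← Real.exp_add, ← Real.exp_add]
          congr 1; push_cast; linarith
        linear_combination a ^ 2 * h1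
      apply this
      field_simp
      ring
    calc ((c ^ (1 / 2 : ℝ) * e) * gaussianPDF (d / 2) v y) ^ 2
        = c * (e ^ 2 * gaussianPDF (d / 2) v y ^ 2) := by rw [mul_pow, mul_pow, hc, mul_assoc]
      _ = c * (gaussianPDF 0 v y * gaussianPDF d v y) := by rw [hp]
      _ ≤ (F y * G y) * (gaussianPDF 0 v y * gaussianPDF d v y) := by gcongr; exact h y
      _ = _ := by simp only [Pi.mul_apply]; ring

end General

/-! ### The hard family of environments and its admissibility. -/

/-- The uniform law on the unit interval. -/
noncomputable def uniformLaw : Measure ℝ := volume.restrict (Set.Icc 0 1)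

instance isProbabilityMeasure_uniformLaw : IsProbabilityMeasure uniformLaw :=
  ⟨by simp [uniformLaw]⟩

theorem cdf_uniformLaw {v : ℝ} (h0 : 0 ≤ v) (h1 : v ≤ 1) : cdf uniformLaw v = v := by
  rw [cdf_eq_real, measureReal_def, uniformLaw, Measure.restrict_apply measurableSet_Iic]
  have : Set.Iic v ∩ Set.Icc 0 1 = Set.Icc 0 v := by
    ext x; simp only [Set.mem_inter_iff, Set.mem_Iic, Set.mem_Icc]
    constructor
    · rintro ⟨a, b, c⟩; exact ⟨b, a⟩
    · rintro ⟨a, b⟩; exact ⟨b, a, b.trans h1⟩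
  rw [this, Real.volume_Icc, sub_zero, ENNReal.toReal_ofReal h0]

/-- The environment with constant mean reward `κ`, uniform prices and Gaussian noise. -/
noncomputable def uniformEnv (v : ℝ≥0) (κ : ℝ) : Environment where
  k := fun _ => κ
  priceLaw := uniformLaw
  noiseLaw := gaussianReal 0 v

/-- Telescoping. It shows that the uniform cdf is piecewise linear on any grid, with unit slopes. -/
theorem sum_fin_sub {m : ℕ} (f : Fin (m + 1) → ℝ) :
    ∑ i : Fin m, (f i.succ - f i.castSucc) = f (Fin.last m) - f 0 := by
  have := Finset.sum_range_sub (fun i => if h : i < m + 1 then f ⟨i, h⟩ else 0) m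
  rw [← Fin.sum_univ_eq_sum_range
    (fun i => (if h : i + 1 < m + 1 then f ⟨i + 1, h⟩ else 0)
      - (if h : i < m + 1 then f ⟨i, h⟩ else 0))] at this
  simp only [lt_add_iff_pos_right, zero_lt_one, dite_true, Nat.zero_lt_succ] at this
  rw [show f (Fin.last m) - f 0 = _ from this.symm]
  refine Finset.sum_congr rfl fun i _ => ?_
  have h1 := i.2
  rw [dif_pos (by omega), dif_pos (by omega)]
  rfl

/-- A constant `k` has zero slopes, the uniform cdf has unit slopes, `α < 1` gives `α * w < w`, and
a centred Gaussian is sub-Gaussian with proxy its variance. -/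
theorem isAdmissible_uniformEnv {mk mq : ℕ} (t : Fin (mk + 1) → ℝ) (b : Fin (mq + 1) → ℝ)
    (hb₀ : b 0 = 0) (hb₁ : b (Fin.last mq) = 1) {α : ℝ} (hα₁ : α < 1)
    (v : ℝ≥0) {κ : ℝ} (h0 : 0 ≤ κ) (h1 : κ ≤ 1) :
    (uniformEnv v κ).IsAdmissible t b α v where
  k_piecewise := ⟨0, antitone_const, fun _ => le_rfl, fun τ _ => by simp [uniformEnv]⟩
  k_nonneg _ _ := h0
  k_le_one _ _ := h1
  q_piecewise := ⟨1, fun _ => by simp, fun w hw0 hw1 => by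
    simp only [uniformEnv, cdf_uniformLaw hw0 hw1, Pi.one_apply, one_mul]
    rw [sum_fin_sub (fun i => min (b i) w), hb₀, hb₁, min_eq_right hw1, min_eq_left hw0, sub_zero]⟩
  q_one := cdf_uniformLaw zero_le_one le_rfl
  q_gt w hw hwk := by
    have hw1 : w ≤ 1 := le_trans hwk h1
    simp only [uniformEnv, cdf_uniformLaw hw.le hw1]
    nlinarith
  noise_mean := integral_id_gaussianReal
  noise_subgaussian := ⟨fun s => integrable_exp_mul_gaussianReal s, fun s => by
    simp [uniformEnv, mgf_fun_id_gaussianReal]⟩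

/-! ### Joint measurability in the policy parameter (seed, history) and the randomness of the
episode. -/

section Measurability

@[fun_prop]
theorem measurable_length : Measurable Sample.length := measurable_fst

@[fun_prop]
theorem measurable_arrival (i : ℕ) : Measurable fun s : Sample => s.arrival i := by
  unfold Sample.arrival; fun_prop

@[fun_prop]
theorem measurable_price (i : ℕ) : Measurable fun s : Sample => s.price i := by
  unfold Sample.price; fun_prop

@[fun_prop]
theorem measurable_noise (i : ℕ) : Measurable fun s : Sample => s.noise i := by
  unfold Sample.noise; fun_prop

/-- The second conjunct excludes the degenerate case where no request arrives after the end: `sInf ∅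
= 0` then makes the number of auctions zero. -/
theorem lt_numAuctions_iff (s : Sample) (i : ℕ) :
    i < s.numAuctions ↔ (∀ j ≤ i, s.arrival j ≤ s.length) ∧ ∃ j, s.length < s.arrival j := by
  unfold Sample.numAuctions
  constructor
  · intro h
    refine ⟨fun j hj => not_lt.1 (Nat.notMem_of_lt_sInf (hj.trans_lt h)), ?_⟩
    exact Nat.nonempty_of_pos_sInf ((Nat.zero_le i).trans_lt h)
  · rintro ⟨h1, h2⟩
    by_contra hcon
    exact absurd (Nat.sInf_mem h2) (not_lt.2 (h1 _ (not_lt.1 hcon)))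

@[fun_prop]
theorem measurable_numAuctions : Measurable Sample.numAuctions := by
  refine measurable_of_Ioi fun i => ?_
  have : Sample.numAuctions ⁻¹' Set.Ioi i
      = (⋂ j, ⋂ (_ : j ≤ i), {s : Sample | s.arrival j ≤ s.length}) ∩
        ⋃ j, {s : Sample | s.length < s.arrival j} := by
    ext s
    simp [lt_numAuctions_iff]
  rw [this]
  refine MeasurableSet.inter ?_ ?_
  · exact MeasurableSet.iInter fun j => MeasurableSet.iInter fun _ =>
      measurableSet_le (by fun_prop) (by fun_prop)
  · exact MeasurableSet.iUnion fun j => measurableSet_lt (by fun_prop) (by fun_prop)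

variable {X : Type*} [MeasurableSpace X] {P : X → Policy}

theorem measurable_lastWin (hP : Measurable fun z : X × ℝ => P z.1 z.2) (i : ℕ) :
    Measurable fun z : X × Sample => lastWin (P z.1) z.2 i := by
  induction i with
  | zero => exact measurable_const
  | succ i ih =>
    have h1 : Measurable fun z : X × Sample =>
        (P z.1 (z.2.arrival i - lastWin (P z.1) z.2 i) : ℝ) :=
      measurable_coe_nnreal_real.comp (hP.comp (measurable_fst.prodMk
        (((measurable_arrival i).comp measurable_snd).sub ih)))
    simp only [lastWin]
    exact Measurable.ite (measurableSet_lt ((measurable_price i).comp measurable_snd) h1)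
      ((measurable_arrival i).comp measurable_snd) ih

theorem measurable_age (hP : Measurable fun z : X × ℝ => P z.1 z.2) (i : ℕ) :
    Measurable fun z : X × Sample => age (P z.1) z.2 i :=
  ((measurable_arrival i).comp measurable_snd).sub (measurable_lastWin hP i)

theorem measurable_bid (hP : Measurable fun z : X × ℝ => P z.1 z.2) (i : ℕ) :
    Measurable fun z : X × Sample => P z.1 (age (P z.1) z.2 i) :=
  hP.comp (measurable_fst.prodMk (measurable_age hP i))

theorem measurableSet_wins (hP : Measurable fun z : X × ℝ => P z.1 z.2) (i : ℕ) :
    MeasurableSet {z : X × Sample | Wins (P z.1) z.2 i} :=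
  measurableSet_lt ((measurable_price i).comp measurable_snd)
    (measurable_coe_nnreal_real.comp (measurable_bid hP i))

open Classical in
theorem measurable_payoff {E : Environment} (hE : Measurable E.k)
    (hP : Measurable fun z : X × ℝ => P z.1 z.2) :
    Measurable fun z : X × Sample => payoff E (P z.1) z.2 := by
  have hG : Measurable fun w : ℕ × (X × Sample) => ∑ i ∈ Finset.range w.1,
      if Wins (P w.2.1) w.2.2 i then
        E.k (age (P w.2.1) w.2.2 i) + w.2.2.noise i - w.2.2.price i else 0 := by
    refine measurable_from_prod_countable_right fun n => ?_
    refine Finset.measurable_fun_sum (M := ℝ) (Finset.range n) fun i _ => ?_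
    have h1 : Measurable fun z : X × Sample => E.k (age (P z.1) z.2 i) :=
      hE.comp (measurable_age hP i)
    have h2 : Measurable fun z : X × Sample => z.2.noise i :=
      (measurable_noise i).comp measurable_snd
    have h3 : Measurable fun z : X × Sample => z.2.price i :=
      (measurable_price i).comp measurable_snd
    have h4 : Measurable fun z : X × Sample =>
        E.k (age (P z.1) z.2 i) + z.2.noise i - z.2.price i := (h1.add h2).sub h3
    exact Measurable.ite (measurableSet_wins hP i) h4 measurable_const
  exact hG.comp ((measurable_numAuctions.comp measurable_snd).prodMk measurable_id)

open Classical in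
theorem measurable_record {E : Environment} (hE : Measurable E.k)
    (hP : Measurable fun z : X × ℝ => P z.1 z.2) :
    Measurable fun z : X × Sample => record E (P z.1) z.2 := by
  unfold record
  refine (measurable_length.comp measurable_snd).prodMk
    ((measurable_numAuctions.comp measurable_snd).prodMk
      (Measurable.prodMk ?_ (measurable_payoff hE hP)))
  refine measurable_pi_lambda _ fun i => ?_
  have hw := measurableSet_wins hP i
  have hlt : MeasurableSet {z : X × Sample | i < z.2.numAuctions} :=
    measurableSet_lt measurable_const (measurable_numAuctions.comp measurable_snd)
  refine Measurable.ite hlt ?_ measurable_const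
  refine ((measurable_arrival i).comp measurable_snd).prodMk (Measurable.prodMk ?_ ?_)
  · have : (fun z : X × Sample => decide (Wins (P z.1) z.2 i))
        = fun z => if Wins (P z.1) z.2 i then true else false := by
      ext z; by_cases h : Wins (P z.1) z.2 i <;> simp [h]
    rw [this]
    exact Measurable.ite hw measurable_const measurable_const
  · exact Measurable.ite hw ((measurable_price i).comp measurable_snd) measurable_const

theorem measurable_value (μ γ : ℝ) {E : Environment} (hE : Measurable E.k)
    [SFinite (episodeLaw μ γ E)]
    (hP : Measurable fun z : X × ℝ => P z.1 z.2) :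
    Measurable fun x => value μ γ E (P x) :=
  (measurable_payoff hE hP).stronglyMeasurable.integral_prod_right.measurable

theorem measurable_snoc {R : Type*} [MeasurableSpace R] {Y : Type*} [MeasurableSpace Y] {n : ℕ}
    {f : Y → Fin n → R} {g : Y → R} (hf : Measurable f) (hg : Measurable g) :
    Measurable fun y => (Fin.snoc (α := fun _ => R) (f y) (g y) : Fin (n + 1) → R) := by
  refine measurable_pi_lambda _ fun j => ?_
  refine Fin.lastCases ?_ (fun j => ?_) j
  · simpa using hg
  · simp only [Fin.snoc_castSucc]
    exact (measurable_pi_apply j).comp hf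

theorem Algorithm.measurable_history {Seed : Type*} [MeasurableSpace Seed] (A : Algorithm Seed)
    {E : Environment} (hE : Measurable E.k) (n : ℕ) :
    Measurable fun x : Seed × (ℕ → Sample) => A.history E x.1 x.2 n := by
  induction n with
  | zero => exact measurable_const
  | succ n ih =>
    simp only [Algorithm.history]
    refine measurable_snoc ih ?_
    exact (measurable_record (P := fun y : Seed × (Fin n → Record) => A.policy n y.1 y.2) hE
      (A.measurable_policy n)).comp
      ((measurable_fst.prodMk ih).prodMk ((measurable_pi_apply n).comp measurable_snd))

/-- The history before episode `n` reads only earlier episodes, so episode `n` can be redrawn with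
the history held fixed. -/
theorem Algorithm.history_update {Seed : Type*} [MeasurableSpace Seed] (A : Algorithm Seed)
    (E : Environment) (u : Seed) (ω : ℕ → Sample) (s : Sample) {n m : ℕ} (h : n ≤ m) :
    A.history E u (Function.update ω m s) n = A.history E u ω n := by
  induction n with
  | zero => rfl
  | succ n ih =>
    simp only [Algorithm.history, ih (by omega)]
    rw [Function.update_of_ne (by omega)]

end Measurability

/-! ### Geometric tails of the number of auctions. -/

section NumberOfAuctions

variable {μ γ : ℝ}

/-- Needed for every real `x`, since it is applied to sums of interarrival times, which are
nonnegative only almost surely. -/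
theorem expMeasure_Ici_le (hγ : 0 < γ) (x : ℝ) :
    expMeasure γ (Set.Ici x) ≤ ENNReal.ofReal (Real.exp (-(γ * x))) := by
  have := isProbabilityMeasure_expMeasure hγ
  rcases lt_or_ge x 0 with hx | hx
  · refine prob_le_one.trans ?_
    rw [← ENNReal.ofReal_one]
    refine ENNReal.ofReal_le_ofReal (Real.one_le_exp ?_)
    nlinarith
  · have hna : NullSingletonClass (expMeasure γ) := by
      unfold expMeasure gammaMeasure; infer_instance
    rw [← Set.compl_Iio, prob_compl_eq_one_sub measurableSet_Iio, measure_congr Iio_ae_eq_Iic,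
      ← ENNReal.ofReal_toReal (measure_ne_top _ (Set.Iic x)), ← measureReal_def, ← cdf_eq_real,
      cdf_expMeasure_eq hγ, if_pos hx, ← ENNReal.ofReal_one, ← ENNReal.ofReal_sub]
    · simp
    · rw [sub_nonneg]; apply Real.exp_le_one_iff.2; nlinarith

/-- The tilted density is a multiple of the exponential density of rate μ + γ. The value is the
chance that the next request precedes the end of the episode. -/
theorem lintegral_exp_expMeasure (hμ : 0 < μ) (hγ : 0 < γ) :
    ∫⁻ x, ENNReal.ofReal (Real.exp (-(γ * x))) ∂(expMeasure μ)
      = ENNReal.ofReal (μ / (μ + γ)) := by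
  have h0 : expMeasure μ = volume.withDensity (exponentialPDF μ) := rfl
  have hm : ∀ r, Measurable (exponentialPDF r) := fun r =>
    (measurable_exponentialPDFReal r).ennreal_ofReal
  rw [h0, lintegral_withDensity_eq_lintegral_mul _ (hm μ) (by fun_prop)]
  have : ∀ x, (exponentialPDF μ * fun x => ENNReal.ofReal (Real.exp (-(γ * x)))) x
      = ENNReal.ofReal (μ / (μ + γ)) * exponentialPDF (μ + γ) x := by
    intro x
    simp only [Pi.mul_apply, exponentialPDF_eq]
    rw [← ENNReal.ofReal_mul (by split_ifs <;> positivity), ← ENNReal.ofReal_mul (by positivity)]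
    congr 1
    split_ifs
    · rw [mul_assoc, ← Real.exp_add]
      field_simp
      congr 1; ring
    · simp
  simp_rw [this]
  rw [lintegral_const_mul _ (hm _), lintegral_exponentialPDF_eq_one (by positivity), mul_one]

variable (μ γ) in
/-- The law of the randomness of an episode in the environments `uniformEnv v κ`; it does not
depend on `κ`. -/
noncomputable def uniformEpisodeLaw (v : ℝ≥0) : Measure Sample :=
  episodeLaw μ γ (uniformEnv v 0)

theorem episodeLaw_uniformEnv (v : ℝ≥0) (κ : ℝ) :
    episodeLaw μ γ (uniformEnv v κ) = uniformEpisodeLaw μ γ v := rfl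

theorem uniformEpisodeLaw_eq (v : ℝ≥0) : uniformEpisodeLaw μ γ v = (expMeasure γ).prod
    ((Measure.infinitePi fun _ : ℕ => expMeasure μ).prod
      ((Measure.infinitePi fun _ : ℕ => uniformLaw).prod
        (Measure.infinitePi fun _ : ℕ => gaussianReal 0 v))) := rfl

theorem isProbabilityMeasure_uniformEpisodeLaw (hμ : 0 < μ) (hγ : 0 < γ) (v : ℝ≥0) :
    IsProbabilityMeasure (uniformEpisodeLaw μ γ v) := by
  have := isProbabilityMeasure_expMeasure hγ
  have := isProbabilityMeasure_expMeasure hμ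
  rw [uniformEpisodeLaw_eq]
  infer_instance

theorem lintegral_uniformEpisodeLaw (hμ : 0 < μ) (hγ : 0 < γ) (v : ℝ≥0) {f : Sample → ℝ≥0∞}
    (hf : Measurable f) :
    ∫⁻ s, f s ∂(uniformEpisodeLaw μ γ v) = ∫⁻ T, ∫⁻ τ, ∫⁻ p, ∫⁻ e, f (T, τ, p, e)
      ∂(Measure.infinitePi fun _ : ℕ => gaussianReal 0 v)
      ∂(Measure.infinitePi fun _ : ℕ => uniformLaw)
      ∂(Measure.infinitePi fun _ : ℕ => expMeasure μ) ∂(expMeasure γ) := by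
  have := isProbabilityMeasure_expMeasure hγ
  have := isProbabilityMeasure_expMeasure hμ
  rw [uniformEpisodeLaw_eq, lintegral_prod _ hf.aemeasurable]
  refine lintegral_congr fun T => ?_
  rw [lintegral_prod _ (by fun_prop)]
  refine lintegral_congr fun τ => ?_
  rw [lintegral_prod _ (by fun_prop)]

/-- Integrating over the length first leaves the exponential of −γ times a sum of interarrival
times, which factors into `i + 1` equal integrals. -/
theorem measure_arrival_le (hμ : 0 < μ) (hγ : 0 < γ) (v : ℝ≥0) (i : ℕ) :
    uniformEpisodeLaw μ γ v {s | s.arrival i ≤ s.length}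
      ≤ ENNReal.ofReal (μ / (μ + γ)) ^ (i + 1) := by
  have := isProbabilityMeasure_expMeasure hγ
  have := isProbabilityMeasure_expMeasure hμ
  have hms : MeasurableSet {s : Sample | s.arrival i ≤ s.length} :=
    measurableSet_le (by fun_prop) (by fun_prop)
  rw [← lintegral_indicator_one hms,
    lintegral_uniformEpisodeLaw hμ hγ v (measurable_one.indicator hms)]
  have hmm : MeasurableSet {w : ℝ × (ℕ → ℝ) | ∑ j ∈ Finset.range (i + 1), w.2 j ≤ w.1} :=
    measurableSet_le (by fun_prop) (by fun_prop)
  have hms2 : Measurable (Function.uncurry fun (T : ℝ) (τ : ℕ → ℝ) =>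
      {w : ℝ × (ℕ → ℝ) | ∑ j ∈ Finset.range (i + 1), w.2 j ≤ w.1}.indicator
        (1 : ℝ × (ℕ → ℝ) → ℝ≥0∞) (T, τ)) := measurable_one.indicator hmm
  have h1 : ∀ T (τ p e : ℕ → ℝ), {s : Sample | s.arrival i ≤ s.length}.indicator
      (1 : Sample → ℝ≥0∞) (T, τ, p, e)
      = {w : ℝ × (ℕ → ℝ) | ∑ j ∈ Finset.range (i + 1), w.2 j ≤ w.1}.indicator
        (1 : ℝ × (ℕ → ℝ) → ℝ≥0∞) (T, τ) := fun T τ p e => rfl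
  simp_rw [h1]
  simp only [lintegral_const, measure_univ, mul_one]
  rw [lintegral_lintegral_swap hms2.aemeasurable,
    ← lintegral_exp_expMeasure hμ hγ, ← lintegral_infinitePi_prod _ (by fun_prop)]
  refine lintegral_mono fun τ => ?_
  rw [← ENNReal.ofReal_prod_of_nonneg (fun _ _ => (Real.exp_pos _).le), ← Real.exp_sum]
  have h2 : ∀ T, {w : ℝ × (ℕ → ℝ) | ∑ j ∈ Finset.range (i + 1), w.2 j ≤ w.1}.indicator
        (1 : ℝ × (ℕ → ℝ) → ℝ≥0∞) (T, τ)
      = (Set.Ici (∑ j ∈ Finset.range (i + 1), τ j)).indicator 1 T := fun T => rfl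
  simp_rw [h2]
  rw [lintegral_indicator_one measurableSet_Ici]
  refine (expMeasure_Ici_le hγ _).trans (le_of_eq ?_)
  rw [Finset.sum_neg_distrib, Finset.mul_sum]

theorem measure_lt_numAuctions_le (hμ : 0 < μ) (hγ : 0 < γ) (v : ℝ≥0) (i : ℕ) :
    uniformEpisodeLaw μ γ v {s | i < s.numAuctions}
      ≤ ENNReal.ofReal (μ / (μ + γ)) ^ (i + 1) :=
  (measure_mono fun _ hs => ((lt_numAuctions_iff _ _).1 hs).1 i le_rfl).trans
    (measure_arrival_le hμ hγ v i)

theorem ratio_lt_one (hμ : 0 < μ) (hγ : 0 < γ) : μ / (μ + γ) < 1 := by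
  rw [div_lt_one (by positivity)]; linarith

/-- The degenerate samples are null by the geometric bound. Off them, a length at least 1 and a
first arrival at most 1 suffice, and these are independent events of positive probability. -/
theorem measure_zero_lt_numAuctions_pos (hμ : 0 < μ) (hγ : 0 < γ) (v : ℝ≥0) :
    0 < uniformEpisodeLaw μ γ v {s | 0 < s.numAuctions} := by
  have := isProbabilityMeasure_expMeasure hγ
  have := isProbabilityMeasure_expMeasure hμ
  have hnull : uniformEpisodeLaw μ γ v {s | ∃ j, s.length < s.arrival j}ᶜ = 0 := by
    have hle : ∀ i : ℕ, uniformEpisodeLaw μ γ v {s | ∃ j, s.length < s.arrival j}ᶜ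
        ≤ ENNReal.ofReal (μ / (μ + γ)) ^ (i + 1) := fun i =>
      (measure_mono fun s hs => by
        simp only [Set.mem_compl_iff, Set.mem_ofPred_eq, not_exists, not_lt] at hs
        exact hs i).trans (measure_arrival_le hμ hγ v i)
    have hlim := (ENNReal.tendsto_pow_atTop_nhds_zero_of_lt_one
      (r := ENNReal.ofReal (μ / (μ + γ)))
      (by rw [← ENNReal.ofReal_one]
          exact (ENNReal.ofReal_lt_ofReal_iff one_pos).2 (ratio_lt_one hμ hγ))).comp
      (Filter.tendsto_add_atTop_nat 1)
    exact le_antisymm (ge_of_tendsto' hlim hle) zero_le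
  have hset : {s : Sample | 0 < s.numAuctions}
      = {s | s.arrival 0 ≤ s.length} \ {s | ∃ j, s.length < s.arrival j}ᶜ := by
    ext s
    simp [lt_numAuctions_iff]
  rw [hset, measure_sdiff_null hnull]
  have hsub : (Set.Ici (1 : ℝ)) ×ˢ (((fun τ : ℕ → ℝ => τ 0) ⁻¹' Set.Iic 1) ×ˢ
      (Set.univ : Set ((ℕ → ℝ) × (ℕ → ℝ)))) ⊆ {s : Sample | s.arrival 0 ≤ s.length} := by
    rintro ⟨T, τ, w⟩ ⟨h1, h2, -⟩
    simp only [Set.mem_preimage, Set.mem_Iic, Set.mem_Ici] at h1 h2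
    simp only [Sample.arrival, Sample.length, Set.mem_ofPred_eq, zero_add, Finset.sum_range_one]
    exact h2.trans h1
  refine lt_of_lt_of_le ?_ (measure_mono hsub)
  rw [uniformEpisodeLaw_eq, Measure.prod_prod, Measure.prod_prod, measure_univ, mul_one]
  have hcdf : ∀ {r : ℝ}, 0 < r → expMeasure r (Set.Iic 1)
      = ENNReal.ofReal (1 - Real.exp (-r)) := fun {r} hr => by
    have := isProbabilityMeasure_expMeasure hr
    rw [← ENNReal.ofReal_toReal (measure_ne_top _ (Set.Iic (1 : ℝ))), ← measureReal_def,
      ← cdf_eq_real, cdf_expMeasure_eq hr, if_pos zero_le_one, mul_one]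
  refine ENNReal.mul_pos (ne_of_gt ?_) (ne_of_gt ?_)
  · refine lt_of_lt_of_le ?_ (measure_mono (Set.Ioi_subset_Ici_self))
    rw [← Set.compl_Iic, prob_compl_eq_one_sub measurableSet_Iic, hcdf hγ, tsub_pos_iff_lt,
      ← ENNReal.ofReal_one, ENNReal.ofReal_lt_ofReal_iff one_pos]
    linarith [Real.exp_pos (-γ)]
  · rw [(measurePreserving_eval_infinitePi (fun _ : ℕ => expMeasure μ) 0).measure_preimage
      measurableSet_Iic.nullMeasurableSet, hcdf hμ, ENNReal.ofReal_pos, sub_pos]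
    exact Real.exp_lt_one_iff.2 (by linarith)

/-- The number of auctions has a finite second moment. -/
theorem lintegral_numAuctions_sq_lt_top (hμ : 0 < μ) (hγ : 0 < γ) (v : ℝ≥0) :
    ∫⁻ s, (s.numAuctions : ℝ≥0∞) ^ 2 ∂(uniformEpisodeLaw μ γ v) < ∞ := by
  have hset : ∀ i : ℕ, MeasurableSet {s : Sample | i < s.numAuctions} := fun i =>
    measurableSet_lt measurable_const measurable_numAuctions
  -- A square is a sum of odd numbers, so the second moment is controlled by the tail probabilities
  -- with weights `2 * i + 1`.
  have hsq : ∀ n : ℕ, ((n : ℝ≥0∞)) ^ 2 ≤ ∑ i ∈ Finset.range n, (2 * (i : ℝ≥0∞) + 1) := by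
    intro n
    have : ∑ i ∈ Finset.range n, (2 * i + 1) = n ^ 2 := by
      induction n with
      | zero => simp
      | succ n ih => rw [Finset.sum_range_succ, ih]; ring
    exact_mod_cast this.ge
  have hpt : ∀ s : Sample, (s.numAuctions : ℝ≥0∞) ^ 2
      ≤ ∑' i : ℕ, {s : Sample | i < s.numAuctions}.indicator (fun _ => 2 * (i : ℝ≥0∞) + 1) s := by
    intro s
    refine (hsq _).trans ?_
    refine le_trans (le_of_eq ?_) (ENNReal.sum_le_tsum (Finset.range s.numAuctions))
    refine Finset.sum_congr rfl fun i hi => ?_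
    rw [Set.indicator_of_mem (by simpa using hi)]
  refine (lintegral_mono hpt).trans_lt ?_
  rw [lintegral_tsum fun i => (measurable_const.indicator (hset i)).aemeasurable]
  simp_rw [lintegral_indicator_const (hset _)]
  have hr0 : 0 ≤ μ / (μ + γ) := by positivity
  have hle : ∀ i : ℕ, (2 * (i : ℝ≥0∞) + 1) * uniformEpisodeLaw μ γ v {s | i < s.numAuctions}
      ≤ ENNReal.ofReal ((2 * i + 1) * (μ / (μ + γ)) ^ i) := fun i => by
    rw [ENNReal.ofReal_mul (by positivity), ENNReal.ofReal_pow hr0,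
      show ENNReal.ofReal (2 * (i : ℝ) + 1) = 2 * (i : ℝ≥0∞) + 1 by
        rw [ENNReal.ofReal_add (by positivity) (by positivity), ENNReal.ofReal_mul (by norm_num)]
        simp]
    gcongr
    refine (measure_lt_numAuctions_le hμ hγ v i).trans (pow_le_pow_of_le_one zero_le ?_ (by omega))
    rw [← ENNReal.ofReal_one]
    exact ENNReal.ofReal_le_ofReal (ratio_lt_one hμ hγ).le
  refine (ENNReal.tsum_le_tsum hle).trans_lt ?_
  have hs : Summable fun i : ℕ => (2 * (i : ℝ) + 1) * (μ / (μ + γ)) ^ i := by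
    have hn : ‖μ / (μ + γ)‖ < 1 := by
      rw [Real.norm_of_nonneg hr0]; exact ratio_lt_one hμ hγ
    have h1 := (summable_pow_mul_geometric_of_norm_lt_one 1 hn).mul_left 2
    have h2 := summable_geometric_of_norm_lt_one hn
    refine (h1.add h2).congr fun i => ?_
    ring
  rw [← ENNReal.ofReal_tsum_of_nonneg (fun i => by positivity) hs]
  exact ENNReal.ofReal_lt_top

end NumberOfAuctions

/-! ### Redrawing the price and the noise of one auction. -/

section Resampling

/-- The episode in which the price and the noise of auction `i` are replaced. -/
def resample (i : ℕ) (x : Sample × (ℝ × ℝ)) : Sample :=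
  (x.1.1, x.1.2.1, Function.update x.1.2.2.1 i x.2.1, Function.update x.1.2.2.2 i x.2.2)

variable {μ γ : ℝ}

theorem measurable_resample (i : ℕ) : Measurable (resample i) := by
  have h : Measurable fun x : (ℕ → ℝ) × ℝ => Function.update x.1 i x.2 := measurable_update'
  refine (by fun_prop : Measurable fun x : Sample × (ℝ × ℝ) => x.1.1).prodMk
    ((by fun_prop : Measurable fun x : Sample × (ℝ × ℝ) => x.1.2.1).prodMk (Measurable.prodMk ?_ ?_))
  · exact h.comp (by fun_prop : Measurable fun x : Sample × (ℝ × ℝ) => (x.1.2.2.1, x.2.1))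
  · exact h.comp (by fun_prop : Measurable fun x : Sample × (ℝ × ℝ) => (x.1.2.2.2, x.2.2))

/-- Fubini together with coordinatewise resampling. This encodes the independence of the price and
noise of auction `i` from the age at that auction and from the number of auctions. -/
theorem measurePreserving_resample (hμ : 0 < μ) (hγ : 0 < γ) (v : ℝ≥0) (i : ℕ) :
    MeasurePreserving (resample i)
      ((uniformEpisodeLaw μ γ v).prod (uniformLaw.prod (gaussianReal 0 v)))
      (uniformEpisodeLaw μ γ v) := by
  have := isProbabilityMeasure_uniformEpisodeLaw hμ hγ v
  refine ⟨measurable_resample i, Measure.ext_of_lintegral _ fun f hf => ?_⟩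
  have hfR : Measurable fun x => f (resample i x) := hf.comp (measurable_resample i)
  have hupd : Measurable fun x : (ℕ → ℝ) × ℝ => Function.update x.1 i x.2 := measurable_update'
  rw [lintegral_map hf (measurable_resample i), lintegral_prod _ hfR.aemeasurable,
    lintegral_uniformEpisodeLaw hμ hγ v hfR.lintegral_prod_right',
    lintegral_uniformEpisodeLaw hμ hγ v hf]
  refine lintegral_congr fun T => lintegral_congr fun τ => ?_
  have hf2 : Measurable fun x : (ℕ → ℝ) × (ℕ → ℝ) => f (T, τ, x.1, x.2) := by fun_prop
  rw [lintegral_infinitePi_update uniformLaw i hf2.lintegral_prod_right']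
  refine lintegral_congr fun p => ?_
  have h1 : ∀ e, ∫⁻ w, f (resample i ((T, τ, p, e), w)) ∂(uniformLaw.prod (gaussianReal 0 v))
      = ∫⁻ y, ∫⁻ z, f (T, τ, Function.update p i y, Function.update e i z) ∂(gaussianReal 0 v)
        ∂uniformLaw := fun e => by
    rw [lintegral_prod]
    · rfl
    · exact (hfR.comp measurable_prodMk_left).aemeasurable
  simp_rw [h1]
  have hf3 : Measurable fun x : (ℕ → ℝ) × ℝ × ℝ =>
      f (T, τ, Function.update p i x.2.1, Function.update x.1 i x.2.2) := by
    have ha : Measurable fun x : (ℕ → ℝ) × ℝ × ℝ => Function.update p i x.2.1 :=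
      (measurable_update p).comp (by fun_prop)
    have hb : Measurable fun x : (ℕ → ℝ) × ℝ × ℝ => Function.update x.1 i x.2.2 :=
      hupd.comp (by fun_prop : Measurable fun x : (ℕ → ℝ) × ℝ × ℝ => (x.1, x.2.2))
    exact hf2.comp (ha.prodMk hb)
  have hf4 : Measurable fun x : (ℕ → ℝ) × ℝ => ∫⁻ z,
      f (T, τ, Function.update p i x.2, Function.update x.1 i z) ∂(gaussianReal 0 v) :=
    Measurable.lintegral_prod_right'
      (f := fun w : ((ℕ → ℝ) × ℝ) × ℝ =>
        f (T, τ, Function.update p i w.1.2, Function.update w.1.1 i w.2))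
      (hf3.comp (by fun_prop : Measurable fun w : ((ℕ → ℝ) × ℝ) × ℝ => (w.1.1, w.1.2, w.2)))
  rw [lintegral_lintegral_swap hf4.aemeasurable]
  refine lintegral_congr fun y => ?_
  rw [lintegral_infinitePi_update (gaussianReal 0 v) i
    (f := fun e => f (T, τ, Function.update p i y, e)) (hf2.comp measurable_prodMk_left)]

theorem numAuctions_resample (i : ℕ) (x : Sample × (ℝ × ℝ)) :
    (resample i x).numAuctions = x.1.numAuctions := rfl

/-- The last win before auction `j` involves only the prices of auctions before `j`, none of which
is auction `i`. -/
theorem lastWin_resample (π : Policy) (i : ℕ) (x : Sample × (ℝ × ℝ)) {j : ℕ} (hj : j ≤ i) :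
    lastWin π (resample i x) j = lastWin π x.1 j := by
  induction j with
  | zero => rfl
  | succ j ih =>
    have hp : (resample i x).price j = x.1.price j :=
      Function.update_of_ne (by omega) _ _
    have ha : (resample i x).arrival j = x.1.arrival j := rfl
    simp only [lastWin, ih (by omega), hp, ha]

theorem age_resample (π : Policy) (i : ℕ) (x : Sample × (ℝ × ℝ)) :
    age π (resample i x) i = age π x.1 i := by
  simp only [age, lastWin_resample π i x le_rfl]; rfl

theorem price_resample (i : ℕ) (x : Sample × (ℝ × ℝ)) : (resample i x).price i = x.2.1 :=
  Function.update_self _ _ _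

theorem noise_resample (i : ℕ) (x : Sample × (ℝ × ℝ)) : (resample i x).noise i = x.2.2 :=
  Function.update_self _ _ _

end Resampling

/-! ### The regret of a policy as a sum of squared bidding errors. -/

section Value

variable {μ γ : ℝ}

/-- The mean payoff of a bid `p` when the mean reward is `κ`. -/
noncomputable def meanPayoff (κ p : ℝ) : ℝ := κ ^ 2 / 2 - (min p 1 - κ) ^ 2 / 2

theorem integrable_id_uniformLaw : Integrable (fun y : ℝ => y) uniformLaw :=
  (continuous_id.continuousOn (s := Set.Icc (0 : ℝ) 1)).integrableOn_Icc

theorem integrable_id_gaussianReal (v : ℝ≥0) : Integrable (fun z : ℝ => z) (gaussianReal 0 v) :=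
  (memLp_id_gaussianReal (μ := 0) (v := v) 1).integrable (by norm_num)

theorem integrable_payoff_bound (v : ℝ≥0) :
    Integrable (fun w : ℝ × ℝ => 1 + |w.2| + |w.1|) (uniformLaw.prod (gaussianReal 0 v)) :=
  ((integrable_const 1).add ((integrable_id_gaussianReal v).abs.comp_snd _)).add
    (integrable_id_uniformLaw.abs.comp_fst _)

theorem abs_ite_le {κ y z : ℝ} (h0 : 0 ≤ κ) (h1 : κ ≤ 1) (c : Prop) [Decidable c] :
    |if c then κ + z - y else 0| ≤ 1 + |z| + |y| := by
  split_ifs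
  · refine (abs_sub _ _).trans (add_le_add ((abs_add_le _ _).trans ?_) le_rfl)
    rw [abs_of_nonneg h0]; linarith
  · rw [abs_zero]; positivity

/-- The noise averages out, leaving the integral of κ − y over prices y from 0 to min(p, 1);
completing the square finishes. -/
theorem integral_bid_payoff (v : ℝ≥0) {κ : ℝ} (h0 : 0 ≤ κ) (h1 : κ ≤ 1) {p : ℝ} (hp : 0 ≤ p) :
    ∫ w, (if w.1 < p then κ + w.2 - w.1 else 0) ∂(uniformLaw.prod (gaussianReal 0 v))
      = meanPayoff κ p := by
  have hm : Measurable fun w : ℝ × ℝ => if w.1 < p then κ + w.2 - w.1 else 0 :=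
    Measurable.ite (measurableSet_lt measurable_fst measurable_const) (by fun_prop)
      measurable_const
  have hint : Integrable (fun w : ℝ × ℝ => if w.1 < p then κ + w.2 - w.1 else 0)
      (uniformLaw.prod (gaussianReal 0 v)) :=
    (integrable_payoff_bound v).mono' hm.aestronglyMeasurable
      (Filter.Eventually.of_forall fun w => abs_ite_le h0 h1 _)
  rw [integral_prod _ hint]
  have hz : ∀ y, ∫ z, (if y < p then κ + z - y else 0) ∂(gaussianReal 0 v)
      = (Set.Iio p).indicator (fun y => κ - y) y := fun y => by
    by_cases hy : y < p
    · simp only [hy, if_true]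
      rw [Set.indicator_of_mem (by exact hy)]
      have : ∀ z, κ + z - y = (κ - y) + z := fun z => by ring
      simp_rw [this]
      rw [integral_add (integrable_const _) (integrable_id_gaussianReal v), integral_id_gaussianReal]
      simp
    · simp only [hy, if_false, integral_zero]
      rw [Set.indicator_of_notMem (by exact hy)]
  simp only [hz]
  rw [integral_indicator measurableSet_Iio, uniformLaw, Measure.restrict_restrict measurableSet_Iio,
    setIntegral_congr_set (t := Set.Ioc 0 (min p 1)), ← intervalIntegral.integral_of_le
      (le_min hp zero_le_one)]
  · rw [intervalIntegral.integral_sub (by simp) (by simp), integral_id]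
    simp only [intervalIntegral.integral_const, meanPayoff, smul_eq_mul]
    ring
  · have : Set.Ioo (0 : ℝ) (min p 1) ⊆ Set.Iio p ∩ Set.Icc 0 1 := fun y hy =>
      ⟨hy.2.trans_le (min_le_left _ _), hy.1.le, (hy.2.trans_le (min_le_right _ _)).le⟩
    have h2 : Set.Iio p ∩ Set.Icc 0 1 ⊆ Set.Icc (0 : ℝ) (min p 1) := fun y hy =>
      ⟨hy.2.1, le_min (le_of_lt hy.1) hy.2.2⟩
    have e1 : (Set.Ioo (0 : ℝ) (min p 1)) =ᵐ[volume] Set.Icc (0 : ℝ) (min p 1) := Ioo_ae_eq_Icc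
    have e2 : (Set.Iio p ∩ Set.Icc 0 1 : Set ℝ) =ᵐ[volume] Set.Icc (0 : ℝ) (min p 1) :=
      Filter.EventuallyLE.antisymm (Filter.Eventually.of_forall fun y hy => h2 hy)
        (e1.symm.le.trans (Filter.Eventually.of_forall fun y hy => this hy))
    exact e2.trans Ioc_ae_eq_Icc.symm

open Classical in
/-- The contribution of auction `i` to the payoff. -/
noncomputable def payoffTerm (κ : ℝ) (π : Policy) (i : ℕ) (s : Sample) : ℝ :=
  if i < s.numAuctions then (if Wins π s i then κ + s.noise i - s.price i else 0) else 0

open Classical in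
theorem payoff_eq_tsum (v : ℝ≥0) (κ : ℝ) (π : Policy) (s : Sample) :
    payoff (uniformEnv v κ) π s = ∑' i, payoffTerm κ π i s := by
  rw [tsum_eq_sum (s := Finset.range s.numAuctions)]
  · refine Finset.sum_congr rfl fun i hi => ?_
    rw [payoffTerm, if_pos (Finset.mem_range.1 hi)]
    rfl
  · intro i hi
    rw [payoffTerm, if_neg (by simpa using hi)]

theorem measurableSet_lt_numAuctions (i : ℕ) : MeasurableSet {s : Sample | i < s.numAuctions} :=
  measurableSet_lt measurable_const measurable_numAuctions

theorem measurable_bid_policy {π : Policy} (hπ : Measurable π) (i : ℕ) :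
    Measurable fun s : Sample => π (age π s i) :=
  (measurable_bid (X := Unit) (P := fun _ => π) (hπ.comp measurable_snd) i).comp
    (measurable_prodMk_left (x := ()))

theorem measurable_payoffTerm (κ : ℝ) {π : Policy} (hπ : Measurable π) (i : ℕ) :
    Measurable (payoffTerm κ π i) := by
  classical
  have hw : MeasurableSet {s : Sample | Wins π s i} :=
    measurableSet_lt (measurable_price i)
      (measurable_coe_nnreal_real.comp (measurable_bid_policy hπ i))
  have h1 : Measurable fun s : Sample => κ + s.noise i - s.price i := by fun_prop
  exact Measurable.ite (measurableSet_lt_numAuctions i)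
    (Measurable.ite hw h1 measurable_const) measurable_const

theorem summable_prob_lt_numAuctions (hμ : 0 < μ) (hγ : 0 < γ) (v : ℝ≥0) :
    Summable fun i : ℕ => (uniformEpisodeLaw μ γ v).real {s | i < s.numAuctions} := by
  have hr0 : 0 ≤ μ / (μ + γ) := by positivity
  refine Summable.of_nonneg_of_le (fun i => measureReal_nonneg) (fun i => ?_)
    ((summable_nat_add_iff 1).2 (summable_geometric_of_lt_one hr0 (ratio_lt_one hμ hγ)))
  rw [measureReal_def]
  refine ENNReal.toReal_le_of_le_ofReal (by positivity) ?_
  rw [ENNReal.ofReal_pow hr0]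
  exact measure_lt_numAuctions_le hμ hγ v i

open Classical in
/-- The value of a policy is the sum over the auctions of the mean payoffs of its bids. -/
theorem hasSum_value (hμ : 0 < μ) (hγ : 0 < γ) (v : ℝ≥0) {κ : ℝ} (h0 : 0 ≤ κ) (h1 : κ ≤ 1)
    {π : Policy} (hπ : Measurable π) :
    HasSum (fun i : ℕ => ∫ s, {s : Sample | i < s.numAuctions}.indicator
        (fun s => meanPayoff κ (π (age π s i))) s ∂(uniformEpisodeLaw μ γ v))
      (value μ γ (uniformEnv v κ) π) := by
  have := isProbabilityMeasure_uniformEpisodeLaw hμ hγ v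
  set ν := uniformLaw.prod (gaussianReal 0 v) with hν
  set L := uniformEpisodeLaw μ γ v with hL
  -- A dominating function free of the policy. After resampling its integral factors into a tail
  -- probability times a constant, hence is summable in `i`.
  set B : ℕ → Sample → ℝ := fun i s => {s : Sample | i < s.numAuctions}.indicator 1 s *
    (1 + |s.noise i| + |s.price i|) with hB
  have hBR : ∀ i x, B i (resample i x) =
      {s : Sample | i < s.numAuctions}.indicator 1 x.1 * (1 + |x.2.2| + |x.2.1|) := fun i x => by
    simp only [hB, noise_resample, price_resample]; rfl
  have hBm : ∀ i, Measurable (B i) := fun i => by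
    have : Measurable fun s : Sample => 1 + |s.noise i| + |s.price i| := by fun_prop
    exact (measurable_one.indicator (measurableSet_lt_numAuctions i)).mul this
  have hmp : ∀ i, MeasurePreserving (resample i) (L.prod ν) L := fun i =>
    measurePreserving_resample hμ hγ v i
  have hIind : ∀ i : ℕ, Integrable ({s : Sample | i < s.numAuctions}.indicator
      (1 : Sample → ℝ)) L := fun i =>
    (integrable_const (1 : ℝ)).indicator (measurableSet_lt_numAuctions i)
  have hBint : ∀ i, Integrable (B i) L := fun i => by
    rw [← (hmp i).integrable_comp (hBm i).aestronglyMeasurable]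
    refine ((hIind i).mul_prod (integrable_payoff_bound v)).congr
      (Filter.Eventually.of_forall fun x => ?_)
    exact (hBR i x).symm
  have hle : ∀ i s, ‖payoffTerm κ π i s‖ ≤ B i s := fun i s => by
    simp only [payoffTerm, hB]
    by_cases hi : i < s.numAuctions
    · rw [if_pos hi, Set.indicator_of_mem (by exact hi), Pi.one_apply, one_mul]
      exact abs_ite_le h0 h1 _
    · rw [if_neg hi, Set.indicator_of_notMem (by exact hi)]; simp
  have hTint : ∀ i, Integrable (payoffTerm κ π i) L := fun i =>
    (hBint i).mono' (measurable_payoffTerm κ hπ i).aestronglyMeasurable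
      (Filter.Eventually.of_forall (hle i))
  have hBval : ∀ i, ∫ s, B i s ∂L = L.real {s | i < s.numAuctions} *
      ∫ w, (1 + |w.2| + |w.1|) ∂ν := fun i => by
    rw [← integral_indicator_one (measurableSet_lt_numAuctions i), ← integral_prod_mul]
    conv_lhs => rw [← (hmp i).map_eq]
    rw [integral_map (hmp i).measurable.aemeasurable
        (by rw [(hmp i).map_eq]; exact (hBm i).aestronglyMeasurable)]
    exact integral_congr_ae (Filter.Eventually.of_forall fun x => hBR i x)
  have hsum := hasSum_integral_of_summable_integral_norm hTint
    (Summable.of_nonneg_of_le (fun i => integral_nonneg fun s => norm_nonneg _)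
      (fun i => (integral_mono (hTint i).norm (hBint i) (hle i)).trans_eq (hBval i))
      ((summable_prob_lt_numAuctions hμ hγ v).mul_right _))
  have hval : value μ γ (uniformEnv v κ) π = ∫ s, ∑' i, payoffTerm κ π i s ∂L := by
    rw [value, episodeLaw_uniformEnv]
    exact integral_congr_ae (Filter.Eventually.of_forall fun s => payoff_eq_tsum v κ π s)
  rw [hval]
  refine (congrArg (fun f : ℕ → ℝ => HasSum f _) (funext fun i => ?_)).mpr hsum
  have hTm : AEStronglyMeasurable (payoffTerm κ π i) (Measure.map (resample i) (L.prod ν)) := by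
    rw [(hmp i).map_eq]; exact (measurable_payoffTerm κ hπ i).aestronglyMeasurable
  have hint2 : Integrable (fun x => payoffTerm κ π i (resample i x)) (L.prod ν) :=
    ((hmp i).integrable_comp (measurable_payoffTerm κ hπ i).aestronglyMeasurable).2 (hTint i)
  -- Redraw price and noise of auction `i` and integrate them first: the bid is then a constant.
  conv_rhs => rw [← (hmp i).map_eq]
  rw [integral_map (hmp i).measurable.aemeasurable hTm, integral_prod _ hint2]
  refine integral_congr_ae (Filter.Eventually.of_forall fun s => ?_)
  simp only [payoffTerm, Wins, numAuctions_resample, age_resample, noise_resample, price_resample]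
  by_cases hi : i < s.numAuctions
  · rw [Set.indicator_of_mem (by exact hi)]
    simp only [hi, if_true]
    exact (integral_bid_payoff v h0 h1 (π (age π s i)).2).symm
  · rw [Set.indicator_of_notMem (by exact hi)]
    simp [hi]

theorem abs_gap_integrand_le {p κ : ℝ} (hp : 0 ≤ p) (h0 : 0 ≤ κ) (h1 : κ ≤ 1) :
    |(min p 1 - κ) ^ 2 / 2| ≤ 1 := by
  have h2 : 0 ≤ min p 1 := le_min hp zero_le_one
  have h3 : min p 1 ≤ 1 := min_le_right _ _
  rw [abs_of_nonneg (by positivity)]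
  nlinarith

/-- The gap between the value of bidding `κ` and the value of a policy. -/
theorem hasSum_value_sub (hμ : 0 < μ) (hγ : 0 < γ) (v : ℝ≥0) {κ : ℝ≥0} (h1 : κ ≤ 1)
    {π : Policy} (hπ : Measurable π) :
    HasSum (fun i : ℕ => ∫ s, {s : Sample | i < s.numAuctions}.indicator
        (fun s => (min (π (age π s i) : ℝ) 1 - κ) ^ 2 / 2) s ∂(uniformEpisodeLaw μ γ v))
      (value μ γ (uniformEnv v κ) (fun _ => κ) - value μ γ (uniformEnv v κ) π) := by
  have := isProbabilityMeasure_uniformEpisodeLaw hμ hγ v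
  have hκ1 : (κ : ℝ) ≤ 1 := by exact_mod_cast h1
  have ha := hasSum_value hμ hγ v κ.coe_nonneg hκ1 (measurable_const (a := κ) : Measurable fun _ : ℝ => κ)
  have hb := hasSum_value hμ hγ v κ.coe_nonneg hκ1 hπ
  have hmb : ∀ i, Measurable fun s => (min (π (age π s i) : ℝ) 1 - κ) ^ 2 / 2 := fun i => by
    have := measurable_coe_nnreal_real.comp (measurable_bid_policy hπ i)
    exact (((this.min measurable_const).sub_const _).pow_const 2).div_const 2
  refine (congrArg (fun f : ℕ → ℝ => HasSum f _) (funext fun i => ?_)).mpr (ha.sub hb)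
  have hi1 : Integrable (fun s => (min (π (age π s i) : ℝ) 1 - κ) ^ 2 / 2)
      (uniformEpisodeLaw μ γ v) :=
    (integrable_const (1 : ℝ)).mono' (hmb i).aestronglyMeasurable
      (Filter.Eventually.of_forall fun s =>
        abs_gap_integrand_le (π _).2 κ.2 hκ1)
  rw [← integral_sub]
  · refine integral_congr_ae (Filter.Eventually.of_forall fun s => ?_)
    by_cases hi : i < s.numAuctions
    · simp only [Set.indicator_of_mem (show s ∈ {s : Sample | i < s.numAuctions} from hi),
        meanPayoff, min_eq_left hκ1]
      ring
    · simp only [Set.indicator_of_notMem (show s ∉ {s : Sample | i < s.numAuctions} from hi),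
        sub_zero]
  · exact (integrable_const _).indicator (measurableSet_lt_numAuctions i)
  · exact ((integrable_const _).sub hi1).indicator (measurableSet_lt_numAuctions i)

theorem value_le_value_const (hμ : 0 < μ) (hγ : 0 < γ) (v : ℝ≥0) {κ : ℝ≥0} (h1 : κ ≤ 1)
    {π : Policy} (hπ : Measurable π) :
    value μ γ (uniformEnv v κ) π ≤ value μ γ (uniformEnv v κ) (fun _ => κ) :=
  sub_nonneg.1 ((hasSum_value_sub hμ hγ v h1 hπ).nonneg fun i => integral_nonneg fun s =>
    Set.indicator_nonneg (fun _ _ => by positivity) s)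

theorem optimalValue_uniformEnv (hμ : 0 < μ) (hγ : 0 < γ) (v : ℝ≥0) {κ : ℝ≥0} (h1 : κ ≤ 1) :
    optimalValue μ γ (uniformEnv v κ) = value μ γ (uniformEnv v κ) (fun _ => κ) := by
  have hle : ∀ π : {π : Policy // Measurable π}, value μ γ (uniformEnv v κ) π.1
      ≤ value μ γ (uniformEnv v κ) (fun _ => κ) := fun π => value_le_value_const hμ hγ v h1 π.2
  have : Nonempty {π : Policy // Measurable π} := ⟨⟨fun _ => κ, measurable_const⟩⟩
  refine le_antisymm (ciSup_le hle) ?_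
  exact le_ciSup (f := fun π : {π : Policy // Measurable π} => value μ γ (uniformEnv v κ) π.1)
    ⟨_, Set.forall_mem_range.2 hle⟩ ⟨fun _ => κ, measurable_const⟩

/-- The regret of a policy over one episode. -/
noncomputable def gap (μ γ : ℝ) (v κ : ℝ≥0) (π : Policy) : ℝ :=
  optimalValue μ γ (uniformEnv v κ) - value μ γ (uniformEnv v κ) π

theorem gap_nonneg (hμ : 0 < μ) (hγ : 0 < γ) (v : ℝ≥0) {κ : ℝ≥0} (h1 : κ ≤ 1)
    {π : Policy} (hπ : Measurable π) : 0 ≤ gap μ γ v κ π := by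
  rw [gap, optimalValue_uniformEnv hμ hγ v h1, sub_nonneg]
  exact value_le_value_const hμ hγ v h1 hπ

/-- Each auction costs at most 1. The bound is uniform in the policy, which makes the random regret
integrable. -/
theorem gap_le (hμ : 0 < μ) (hγ : 0 < γ) (v : ℝ≥0) {κ : ℝ≥0} (h1 : κ ≤ 1)
    {π : Policy} (hπ : Measurable π) :
    gap μ γ v κ π ≤ ∑' i : ℕ, (uniformEpisodeLaw μ γ v).real {s | i < s.numAuctions} := by
  have := isProbabilityMeasure_uniformEpisodeLaw hμ hγ v
  rw [gap, optimalValue_uniformEnv hμ hγ v h1]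
  refine hasSum_le (fun i => ?_) (hasSum_value_sub hμ hγ v h1 hπ)
    (summable_prob_lt_numAuctions hμ hγ v).hasSum
  rw [← integral_indicator_one (measurableSet_lt_numAuctions i)]
  refine integral_mono_of_nonneg (Filter.Eventually.of_forall fun s =>
    Set.indicator_nonneg (fun _ _ => by positivity) s)
    ((integrable_const (1 : ℝ)).indicator (measurableSet_lt_numAuctions i))
    (Filter.Eventually.of_forall fun s => ?_)
  refine Set.indicator_le_indicator ?_
  exact (le_abs_self _).trans (abs_gap_integrand_le (π _).2 κ.2 (by exact_mod_cast h1))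

/-- No policy is close to optimal for two different mean rewards. -/
theorem le_gap_add_gap (hμ : 0 < μ) (hγ : 0 < γ) (v : ℝ≥0) {κ κ' : ℝ≥0} (h1 : κ ≤ 1)
    (h1' : κ' ≤ 1) {π : Policy} (hπ : Measurable π) :
    (uniformEpisodeLaw μ γ v).real {s | 0 < s.numAuctions} * (((κ : ℝ) - κ') ^ 2 / 4)
      ≤ gap μ γ v κ π + gap μ γ v κ' π := by
  have := isProbabilityMeasure_uniformEpisodeLaw hμ hγ v
  -- The first auction alone is enough: the other terms of the gap are nonnegative.
  have hfirst : ∀ {κ : ℝ≥0}, κ ≤ 1 → ∫ s, {s : Sample | 0 < s.numAuctions}.indicator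
      (fun s => (min (π (age π s 0) : ℝ) 1 - κ) ^ 2 / 2) s ∂(uniformEpisodeLaw μ γ v)
        ≤ gap μ γ v κ π := fun {κ} h1 => by
    rw [gap, optimalValue_uniformEnv hμ hγ v h1]
    exact le_hasSum (hasSum_value_sub hμ hγ v h1 hπ) 0 fun i _ => integral_nonneg fun s =>
      Set.indicator_nonneg (fun _ _ => by positivity) s
  have hint : ∀ {κ : ℝ≥0}, κ ≤ 1 → Integrable ({s : Sample | 0 < s.numAuctions}.indicator
      (fun s => (min (π (age π s 0) : ℝ) 1 - κ) ^ 2 / 2)) (uniformEpisodeLaw μ γ v) :=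
    fun {κ} h1 => by
    have hm : Measurable fun s => (min (π (age π s 0) : ℝ) 1 - κ) ^ 2 / 2 := by
      have := measurable_coe_nnreal_real.comp (measurable_bid_policy hπ 0)
      exact (((this.min measurable_const).sub_const _).pow_const 2).div_const 2
    exact ((integrable_const (1 : ℝ)).mono' hm.aestronglyMeasurable (Filter.Eventually.of_forall
      fun s => abs_gap_integrand_le (π _).2 κ.2 (by exact_mod_cast h1))).indicator
        (measurableSet_lt_numAuctions 0)
  refine le_trans ?_ (add_le_add (hfirst h1) (hfirst h1'))
  rw [← integral_add (hint h1) (hint h1'), ← smul_eq_mul,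
    ← integral_indicator_const _ (measurableSet_lt_numAuctions 0)]
  refine integral_mono ((integrable_const _).indicator (measurableSet_lt_numAuctions 0))
    ((hint h1).add (hint h1')) fun s => ?_
  by_cases hi : 0 < s.numAuctions
  · simp only [Set.indicator_of_mem (show s ∈ {s : Sample | 0 < s.numAuctions} from hi)]
    -- With errors a, b whose difference is κ' − κ: (a² + b²)/2 = ((a − b)² + (a + b)²)/4.
    nlinarith [sq_nonneg ((min (π (age π s 0) : ℝ) 1 - κ) + (min (π (age π s 0) : ℝ) 1 - κ'))]
  · simp only [Set.indicator_of_notMem (show s ∉ {s : Sample | 0 < s.numAuctions} from hi)]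
    simp

end Value

/-! ### Affinity of the observations under two mean rewards. -/

section Affinity

variable {μ γ : ℝ}

/-- Wins ignore the noise, so the set of auctions won stays fixed while the noise is integrated. -/
theorem lastWin_congr (π : Policy) {s s' : Sample} (h1 : s.2.1 = s'.2.1) (h2 : s.2.2.1 = s'.2.2.1)
    (i : ℕ) : lastWin π s i = lastWin π s' i := by
  have ha : ∀ j, s.arrival j = s'.arrival j := fun j => by simp only [Sample.arrival, h1]
  have hp : ∀ j, s.price j = s'.price j := fun j => by simp only [Sample.price, h2]
  induction i with
  | zero => rfl
  | succ i ih => simp only [lastWin, ih, ha, hp]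

theorem age_congr (π : Policy) {s s' : Sample} (h1 : s.2.1 = s'.2.1) (h2 : s.2.2.1 = s'.2.2.1)
    (i : ℕ) : age π s i = age π s' i := by
  simp only [age, lastWin_congr π h1 h2, Sample.arrival, h1]

theorem wins_congr (π : Policy) {s s' : Sample} (h1 : s.2.1 = s'.2.1) (h2 : s.2.2.1 = s'.2.2.1)
    (i : ℕ) : Wins π s i ↔ Wins π s' i := by
  simp only [Wins, age_congr π h1 h2, Sample.price, h2]

open Classical in
/-- A change of the mean reward has the same effect on the record of an episode as a translation
of one of the noise variables. -/
theorem exists_record_eq_record_update (v : ℝ≥0) (κ κ' : ℝ) (π : Policy) (s : Sample) :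
    ∃ (i : ℕ) (d : ℝ), d ^ 2 ≤ (s.numAuctions : ℝ) ^ 2 * (κ' - κ) ^ 2 ∧ ∀ e : ℕ → ℝ,
      record (uniformEnv v κ') π (s.1, s.2.1, s.2.2.1, e)
        = record (uniformEnv v κ) π (s.1, s.2.1, s.2.2.1, Function.update e i (e i + d)) := by
  set W := (Finset.range s.numAuctions).filter (Wins π s) with hW
  have hpay : ∀ (κ : ℝ) (e : ℕ → ℝ), payoff (uniformEnv v κ) π (s.1, s.2.1, s.2.2.1, e)
      = ∑ i ∈ W, (κ + e i - s.price i) := fun κ e => by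
    rw [payoff, hW, Finset.sum_filter]
    refine Finset.sum_congr rfl fun i _ => ?_
    exact if_congr (wins_congr π (s := (s.1, s.2.1, s.2.2.1, e)) (s' := s) rfl rfl i) rfl rfl
  obtain ⟨i, d, hd, hpe⟩ : ∃ (i : ℕ) (d : ℝ), d ^ 2 ≤ (s.numAuctions : ℝ) ^ 2 * (κ' - κ) ^ 2 ∧
      ∀ e : ℕ → ℝ, ∑ j ∈ W, (κ' + e j - s.price j)
        = ∑ j ∈ W, (κ + Function.update e i (e i + d) j - s.price j) := by
    rcases W.eq_empty_or_nonempty with h | ⟨i, hi⟩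
    · exact ⟨0, 0, by rw [zero_pow two_ne_zero]; positivity, fun e => by simp [h]⟩
    -- Only the total payoff is observed, so its whole change can be charged to the noise of a
    -- single won auction. Without a win the record does not depend on κ.
    · refine ⟨i, W.card * (κ' - κ), ?_, fun e => ?_⟩
      · rw [mul_pow]
        have : W.card ≤ s.numAuctions := (Finset.card_filter_le _ _).trans (by simp)
        gcongr
      · have hu : ∀ j, κ + Function.update e i (e i + W.card * (κ' - κ)) j - s.price j
            = (κ + e j - s.price j) + if i = j then W.card * (κ' - κ) else 0 := fun j => by
          by_cases hj : i = j
          · subst hj; simp; ring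
          · rw [Function.update_of_ne (Ne.symm hj), if_neg hj, add_zero]
        simp_rw [hu]
        rw [Finset.sum_add_distrib, Finset.sum_ite_eq, if_pos hi, ← nsmul_eq_mul,
          ← Finset.sum_const, ← Finset.sum_add_distrib]
        exact Finset.sum_congr rfl fun j _ => by ring
  refine ⟨i, d, hd, fun e => ?_⟩
  have hw : ∀ j (e e' : ℕ → ℝ), Wins π (s.1, s.2.1, s.2.2.1, e) j
      = Wins π (s.1, s.2.1, s.2.2.1, e') j := fun j e e' => propext
    (wins_congr π (s := (s.1, s.2.1, s.2.2.1, e)) (s' := (s.1, s.2.1, s.2.2.1, e')) rfl rfl j)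
  simp only [record, hpay, hpe e, hw _ e (Function.update e i (e i + d))]
  rfl

/-- The dual affinity bound for two equal laws, without loss. It absorbs the noise coordinates that
are not shifted. -/
theorem le_lintegral_mul_lintegral {X : Type*} [MeasurableSpace X] (ν : Measure X)
    [IsProbabilityMeasure ν] {c : ℝ≥0∞} {f g : X → ℝ≥0∞} (hf : Measurable f) (hg : Measurable g)
    (h : ∀ x, c ≤ f x * g x) : c ≤ (∫⁻ x, f x ∂ν) * ∫⁻ x, g x ∂ν := by
  have hc : (c ^ (1 / 2 : ℝ)) ^ 2 = c := by
    rw [← ENNReal.rpow_natCast, ← ENNReal.rpow_mul]; norm_num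
  have := sq_lintegral_le_mul_lintegral ν (w := fun _ => c ^ (1 / 2 : ℝ)) hf hg
    (fun x => by rw [hc]; exact h x)
  simpa only [lintegral_const, measure_univ, mul_one, hc] using this

theorem lintegral_uniformEpisodeLaw_noise (hμ : 0 < μ) (hγ : 0 < γ) (v : ℝ≥0)
    {f : Sample → ℝ≥0∞} (hf : Measurable f) :
    ∫⁻ s, f s ∂(uniformEpisodeLaw μ γ v)
      = ∫⁻ s, ∫⁻ e, f (s.1, s.2.1, s.2.2.1, e)
        ∂(Measure.infinitePi fun _ : ℕ => gaussianReal 0 v) ∂(uniformEpisodeLaw μ γ v) := by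
  have hm : Measurable fun x : Sample × (ℕ → ℝ) => f (x.1.1, x.1.2.1, x.1.2.2.1, x.2) :=
    hf.comp (by fun_prop)
  rw [lintegral_uniformEpisodeLaw hμ hγ v hf,
    lintegral_uniformEpisodeLaw hμ hγ v hm.lintegral_prod_right']
  simp

/-- The affinity of the laws of the records of an episode in two environments whose mean rewards
differ by `δ` is at least this quantity. -/
noncomputable def recordAffinity (μ γ : ℝ) (v : ℝ≥0) (δ : ℝ) : ℝ≥0∞ :=
  ∫⁻ s, ENNReal.ofReal (Real.exp (-((s.numAuctions : ℝ) ^ 2 * δ ^ 2) / (8 * v)))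
    ∂(uniformEpisodeLaw μ γ v)

theorem measurable_exp_numAuctions (v : ℝ≥0) (δ : ℝ) : Measurable fun s : Sample =>
    ENNReal.ofReal (Real.exp (-((s.numAuctions : ℝ) ^ 2 * δ ^ 2) / (8 * v))) := by
  have hL : Measurable fun s : Sample => (s.numAuctions : ℝ) :=
    measurable_from_nat.comp measurable_numAuctions
  fun_prop

theorem measurable_uniformEnv_k (v : ℝ≥0) (κ : ℝ) : Measurable (uniformEnv v κ).k :=
  measurable_const

theorem measurable_record_policy (v : ℝ≥0) (κ : ℝ) {π : Policy} (hπ : Measurable π) :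
    Measurable fun s => record (uniformEnv v κ) π s :=
  (measurable_record (X := Unit) (P := fun _ => π) (measurable_uniformEnv_k v κ)
    (hπ.comp measurable_snd)).comp (measurable_prodMk_left (x := ()))

/-- Conditionally on length, arrivals and prices, the two records differ by a shift of one Gaussian
coordinate. The shift bound applies there, with the other noises fixed. -/
theorem record_affinity_of_sample {v : ℝ≥0} (hv : v ≠ 0) (κ κ' : ℝ) {π : Policy}
    (hπ : Measurable π) {c : ℝ≥0∞} {F G : Record → ℝ≥0∞} (hF : Measurable F) (hG : Measurable G)
    (h : ∀ r, c ≤ F r * G r) (s : Sample) :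
    c * ENNReal.ofReal (Real.exp (-((s.numAuctions : ℝ) ^ 2 * (κ' - κ) ^ 2) / (8 * v))) ^ 2
      ≤ (∫⁻ e, F (record (uniformEnv v κ) π (s.1, s.2.1, s.2.2.1, e))
          ∂(Measure.infinitePi fun _ : ℕ => gaussianReal 0 v))
        * ∫⁻ e, G (record (uniformEnv v κ') π (s.1, s.2.1, s.2.2.1, e))
          ∂(Measure.infinitePi fun _ : ℕ => gaussianReal 0 v) := by
  obtain ⟨i, d, hd, hrec⟩ := exists_record_eq_record_update v κ κ' π s
  have hR : Measurable fun e : ℕ → ℝ => record (uniformEnv v κ) π (s.1, s.2.1, s.2.2.1, e) :=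
    (measurable_record_policy v κ hπ).comp (by fun_prop)
  have hupd : Measurable fun x : (ℕ → ℝ) × ℝ => Function.update x.1 i x.2 := measurable_update'
  have hFR := hF.comp hR
  have hGR := hG.comp hR
  have hupd2 : Measurable fun x : (ℕ → ℝ) × ℝ => Function.update x.1 i (x.2 + d) :=
    hupd.comp (by fun_prop : Measurable fun x : (ℕ → ℝ) × ℝ => (x.1, x.2 + d))
  have hGm : Measurable fun e : ℕ → ℝ =>
      G (record (uniformEnv v κ) π (s.1, s.2.1, s.2.2.1, Function.update e i (e i + d))) :=
    hGR.comp (hupd2.comp (by fun_prop : Measurable fun e : ℕ → ℝ => (e, e i)))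
  simp_rw [hrec]
  rw [lintegral_infinitePi_update _ i hGm]
  have hF2 := lintegral_infinitePi_update (gaussianReal 0 v) i hFR
  simp only [Function.comp_apply] at hF2
  rw [hF2]
  simp only [Function.update_idem, Function.update_self]
  refine le_lintegral_mul_lintegral _ (hFR.comp hupd).lintegral_prod_right'
    (hGR.comp hupd2).lintegral_prod_right' fun e => ?_
  refine le_trans ?_ (gaussianReal_shift_affinity hv d
    (F := fun y => F (record (uniformEnv v κ) π (s.1, s.2.1, s.2.2.1, Function.update e i y)))
    (G := fun y => G (record (uniformEnv v κ) π (s.1, s.2.1, s.2.2.1, Function.update e i y)))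
    ((hFR.comp hupd).comp measurable_prodMk_left) ((hGR.comp hupd).comp measurable_prodMk_left)
    fun y => h _)
  gcongr

/-- Cauchy–Schwarz over length, arrivals and prices, whose joint law is the same for κ and κ'. -/
theorem record_affinity (hμ : 0 < μ) (hγ : 0 < γ) {v : ℝ≥0} (hv : v ≠ 0) (κ κ' : ℝ) {π : Policy}
    (hπ : Measurable π) {c : ℝ≥0∞} {F G : Record → ℝ≥0∞} (hF : Measurable F) (hG : Measurable G)
    (h : ∀ r, c ≤ F r * G r) :
    c * recordAffinity μ γ v (κ' - κ) ^ 2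
      ≤ (∫⁻ s, F (record (uniformEnv v κ) π s) ∂(uniformEpisodeLaw μ γ v))
        * ∫⁻ s, G (record (uniformEnv v κ') π s) ∂(uniformEpisodeLaw μ γ v) := by
  have hc : (c ^ (1 / 2 : ℝ)) ^ 2 = c := by
    rw [← ENNReal.rpow_natCast, ← ENNReal.rpow_mul]; norm_num
  have hFR := hF.comp (measurable_record_policy v κ hπ)
  have hGR := hG.comp (measurable_record_policy v κ' hπ)
  have hm : Measurable fun x : Sample × (ℕ → ℝ) =>
      ((x.1.1, x.1.2.1, x.1.2.2.1, x.2) : Sample) := by fun_prop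
  have hF2 := lintegral_uniformEpisodeLaw_noise hμ hγ v hFR
  have hG2 := lintegral_uniformEpisodeLaw_noise hμ hγ v hGR
  simp only [Function.comp_apply] at hF2 hG2
  rw [hF2, hG2]
  refine le_trans (le_of_eq ?_) (sq_lintegral_le_mul_lintegral _
    (w := fun s => c ^ (1 / 2 : ℝ) *
      ENNReal.ofReal (Real.exp (-((s.numAuctions : ℝ) ^ 2 * (κ' - κ) ^ 2) / (8 * v))))
    (hFR.comp hm).lintegral_prod_right' (hGR.comp hm).lintegral_prod_right' fun s => ?_)
  · rw [lintegral_const_mul _ (measurable_exp_numAuctions v _), mul_pow, hc]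
    rfl
  · rw [mul_pow, hc]
    exact record_affinity_of_sample hv κ κ' hπ hF hG h s

theorem measurable_policy {Seed : Type*} [MeasurableSpace Seed] (A : Algorithm Seed) (n : ℕ)
    (u : Seed) (h : Fin n → Record) : Measurable (A.policy n u h) :=
  (A.measurable_policy n).comp (measurable_prodMk_left (x := (u, h)))

/-- Given a common history the same policy is played in both environments. Integrating out the last
episode therefore turns `f`, `g` into functions of the shorter history, with `c` multiplied by one
squared affinity. The induction needs all `c`, `f`, `g`. -/
theorem history_affinity (hμ : 0 < μ) (hγ : 0 < γ) {v : ℝ≥0} (hv : v ≠ 0) (κ κ' : ℝ)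
    {Seed : Type*} [MeasurableSpace Seed] (A : Algorithm Seed) (u : Seed) (n : ℕ) :
    ∀ {c : ℝ≥0∞} {f g : (Fin n → Record) → ℝ≥0∞}, Measurable f → Measurable g →
    (∀ h, c ≤ f h * g h) →
    c * (recordAffinity μ γ v (κ' - κ) ^ 2) ^ n
      ≤ (∫⁻ ω, f (A.history (uniformEnv v κ) u ω n)
          ∂(Measure.infinitePi fun _ : ℕ => uniformEpisodeLaw μ γ v))
        * ∫⁻ ω, g (A.history (uniformEnv v κ') u ω n)
          ∂(Measure.infinitePi fun _ : ℕ => uniformEpisodeLaw μ γ v) := by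
  have := isProbabilityMeasure_uniformEpisodeLaw hμ hγ v
  induction n with
  | zero =>
    intro c f g hf hg h
    simpa [Algorithm.history] using h _
  | succ n ih =>
    intro c f g hf hg h
    have hsnoc : ∀ κ, Measurable fun x : (Fin n → Record) × Sample =>
        (Fin.snoc (α := fun _ => Record) x.1 (record (uniformEnv v κ) (A.policy n u x.1) x.2) :
          Fin (n + 1) → Record) := fun κ => by
      refine measurable_snoc measurable_fst ?_
      refine measurable_record (X := Fin n → Record) (P := fun y => A.policy n u y)
        (measurable_uniformEnv_k v κ) ?_
      exact (A.measurable_policy n).comp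
        (by fun_prop : Measurable fun z : (Fin n → Record) × ℝ => ((u, z.1), z.2))
    have hstep : ∀ (κ : ℝ) {f : (Fin (n + 1) → Record) → ℝ≥0∞}, Measurable f →
        ∫⁻ ω, f (A.history (uniformEnv v κ) u ω (n + 1))
          ∂(Measure.infinitePi fun _ : ℕ => uniformEpisodeLaw μ γ v)
        = ∫⁻ ω, (fun h => ∫⁻ s, f (Fin.snoc (α := fun _ => Record) h
            (record (uniformEnv v κ) (A.policy n u h) s)) ∂(uniformEpisodeLaw μ γ v))
              (A.history (uniformEnv v κ) u ω n)
          ∂(Measure.infinitePi fun _ : ℕ => uniformEpisodeLaw μ γ v) := fun κ f hf => by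
      have hm : Measurable fun ω => f (A.history (uniformEnv v κ) u ω (n + 1)) :=
        hf.comp ((A.measurable_history (measurable_uniformEnv_k v κ) (n + 1)).comp
          (measurable_prodMk_left (x := u)))
      rw [lintegral_infinitePi_update _ n hm]
      simp only [Algorithm.history,
        A.history_update _ _ _ _ (le_refl n), Function.update_self]
    rw [hstep κ hf, hstep κ' hg, pow_succ', ← mul_assoc]
    refine ih (hf.comp (hsnoc κ)).lintegral_prod_right' (hg.comp (hsnoc κ')).lintegral_prod_right'
      fun hh => ?_
    have hs : Measurable fun r : Record =>
        (Fin.snoc (α := fun _ => Record) hh r : Fin (n + 1) → Record) :=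
      measurable_snoc measurable_const measurable_id
    exact record_affinity hμ hγ hv κ κ' (measurable_policy A n u hh) (hf.comp hs) (hg.comp hs)
      fun r => h _

/-- Integrate exp(−x) ≥ 1 − x, using the finite second moment. -/
theorem le_recordAffinity (hμ : 0 < μ) (hγ : 0 < γ) {v : ℝ≥0} (hv : v ≠ 0) (δ : ℝ) :
    ENNReal.ofReal (1 - δ ^ 2 / (8 * v) *
      (∫⁻ s, (s.numAuctions : ℝ≥0∞) ^ 2 ∂(uniformEpisodeLaw μ γ v)).toReal)
      ≤ recordAffinity μ γ v δ := by
  have := isProbabilityMeasure_uniformEpisodeLaw hμ hγ v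
  have hv' : (0 : ℝ) < v := by positivity
  set L := uniformEpisodeLaw μ γ v
  have hL' : Measurable fun s : Sample => (s.numAuctions : ℝ≥0∞) :=
    measurable_from_nat.comp measurable_numAuctions
  set θ := δ ^ 2 / (8 * v) with hθ
  have hθ0 : 0 ≤ θ := by positivity
  have hpt : ∀ s : Sample, 1 ≤
      ENNReal.ofReal (Real.exp (-((s.numAuctions : ℝ) ^ 2 * δ ^ 2) / (8 * v)))
        + ENNReal.ofReal θ * (s.numAuctions : ℝ≥0∞) ^ 2 := fun s => by
    have : (s.numAuctions : ℝ≥0∞) ^ 2 = ENNReal.ofReal ((s.numAuctions : ℝ) ^ 2) := by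
      rw [ENNReal.ofReal_pow (by positivity), ENNReal.ofReal_natCast]
    rw [this, ← ENNReal.ofReal_mul hθ0, ← ENNReal.ofReal_add (by positivity) (by positivity),
      ← ENNReal.ofReal_one]
    refine ENNReal.ofReal_le_ofReal ?_
    have h1 := Real.add_one_le_exp (-((s.numAuctions : ℝ) ^ 2 * δ ^ 2) / (8 * v))
    have h2 : -((s.numAuctions : ℝ) ^ 2 * δ ^ 2) / (8 * v) = -(θ * (s.numAuctions : ℝ) ^ 2) := by
      rw [hθ]; ring
    rw [h2] at h1 ⊢
    linarith
  have h1 : (1 : ℝ≥0∞) ≤ recordAffinity μ γ v δ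
      + ENNReal.ofReal θ * ∫⁻ s, (s.numAuctions : ℝ≥0∞) ^ 2 ∂L := by
    rw [recordAffinity, ← lintegral_const_mul _ (hL'.pow_const 2),
      ← lintegral_add_left (measurable_exp_numAuctions v δ)]
    calc (1 : ℝ≥0∞) = ∫⁻ _, 1 ∂L := by simp
      _ ≤ _ := lintegral_mono hpt
  rw [ENNReal.ofReal_sub _ (by positivity), ENNReal.ofReal_one, ENNReal.ofReal_mul hθ0,
    ENNReal.ofReal_toReal (lintegral_numAuctions_sq_lt_top hμ hγ v).ne]
  exact tsub_le_iff_right.2 h1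

/-- Bernoulli's inequality with exponent `2 * n`; the hypothesis says that the total loss is at most
1/2. -/
theorem half_le_recordAffinity_pow (hμ : 0 < μ) (hγ : 0 < γ) {v : ℝ≥0} (hv : v ≠ 0) (δ : ℝ)
    (n : ℕ) (h : n * (δ ^ 2 * (∫⁻ s, (s.numAuctions : ℝ≥0∞) ^ 2
      ∂(uniformEpisodeLaw μ γ v)).toReal) ≤ 2 * v) :
    ENNReal.ofReal (1 / 2) ≤ (recordAffinity μ γ v δ ^ 2) ^ n := by
  have hv' : (0 : ℝ) < v := by positivity
  set M := (∫⁻ s, (s.numAuctions : ℝ≥0∞) ^ 2 ∂(uniformEpisodeLaw μ γ v)).toReal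
  have hM : 0 ≤ M := ENNReal.toReal_nonneg
  rcases Nat.eq_zero_or_pos n with rfl | hn
  · simp
  have hn1 : (1 : ℝ) ≤ n := by exact_mod_cast hn
  have hθ : 2 * n * (δ ^ 2 / (8 * v) * M) ≤ 1 / 2 := by
    rw [show 2 * n * (δ ^ 2 / (8 * v) * M) = n * (δ ^ 2 * M) / (4 * v) by field_simp; ring,
      div_le_iff₀ (by positivity)]
    linarith
  have hθ0 : 0 ≤ δ ^ 2 / (8 * v) * M := by positivity
  have hθ1 : δ ^ 2 / (8 * v) * M ≤ 1 := by nlinarith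
  refine le_trans ?_ (pow_le_pow_left' (pow_le_pow_left' (le_recordAffinity hμ hγ hv δ) 2) n)
  rw [← pow_mul, ← ENNReal.ofReal_pow (by linarith)]
  refine ENNReal.ofReal_le_ofReal ?_
  have := one_add_mul_le_pow (a := -(δ ^ 2 / (8 * v) * M)) (by linarith) (2 * n)
  push_cast at this
  rw [← sub_eq_add_neg] at this
  linarith

end Affinity

/-! ### Two-point bound and averaging over a grid of mean rewards. -/

section LowerBound

variable {μ γ : ℝ} {Seed : Type*} [MeasurableSpace Seed]

theorem measurable_gap_policy (hμ : 0 < μ) (hγ : 0 < γ) (v κ : ℝ≥0) (A : Algorithm Seed) (n : ℕ) :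
    Measurable fun x : Seed × (Fin n → Record) => gap μ γ v κ (A.policy n x.1 x.2) := by
  have : IsProbabilityMeasure (episodeLaw μ γ (uniformEnv v κ)) :=
    isProbabilityMeasure_uniformEpisodeLaw hμ hγ v
  exact (measurable_value μ γ (measurable_uniformEnv_k v κ)
    (P := fun x : Seed × (Fin n → Record) => A.policy n x.1 x.2)
    (A.measurable_policy n)).const_sub _

theorem measurable_gap_played (hμ : 0 < μ) (hγ : 0 < γ) (v κ : ℝ≥0) (A : Algorithm Seed) (n : ℕ) :
    Measurable fun x : Seed × (ℕ → Sample) =>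
      gap μ γ v κ (A.played (uniformEnv v κ) x.1 x.2 n) :=
  (measurable_gap_policy hμ hγ v κ A n).comp
    (measurable_fst.prodMk (A.measurable_history (measurable_uniformEnv_k v κ) n))

/-- The two-point bound, for a given value of the random seed. -/
theorem le_lintegral_gap_add (hμ : 0 < μ) (hγ : 0 < γ) {v : ℝ≥0} (hv : v ≠ 0) {κ κ' : ℝ≥0}
    (h1 : κ ≤ 1) (h1' : κ' ≤ 1) (A : Algorithm Seed) (u : Seed) (n : ℕ)
    (hn : n * (((κ' : ℝ) - κ) ^ 2 * (∫⁻ s, (s.numAuctions : ℝ≥0∞) ^ 2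
      ∂(uniformEpisodeLaw μ γ v)).toReal) ≤ 2 * v) :
    ENNReal.ofReal ((uniformEpisodeLaw μ γ v).real {s | 0 < s.numAuctions} *
        (((κ' : ℝ) - κ) ^ 2 / 16))
      ≤ (∫⁻ ω, ENNReal.ofReal (gap μ γ v κ (A.played (uniformEnv v κ) u ω n))
          ∂(Measure.infinitePi fun _ : ℕ => uniformEpisodeLaw μ γ v))
        + ∫⁻ ω, ENNReal.ofReal (gap μ γ v κ' (A.played (uniformEnv v κ') u ω n))
          ∂(Measure.infinitePi fun _ : ℕ => uniformEpisodeLaw μ γ v) := by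
  have := isProbabilityMeasure_uniformEpisodeLaw hμ hγ v
  set p := (uniformEpisodeLaw μ γ v).real {s | 0 < s.numAuctions} with hp
  have hp0 : 0 ≤ p := measureReal_nonneg
  set D := p * (((κ : ℝ) - κ') ^ 2 / 4) with hD
  have hD0 : 0 ≤ D := by positivity
  rw [show p * (((κ' : ℝ) - κ) ^ 2 / 16) = D / 4 by rw [hD]; ring]
  have hg0 : ∀ {κ : ℝ≥0}, κ ≤ 1 → ∀ h, 0 ≤ gap μ γ v κ (A.policy n u h) := fun h1 h =>
    gap_nonneg hμ hγ v h1 (measurable_policy A n u h)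
  have hm : ∀ κ, Measurable fun h => gap μ γ v κ (A.policy n u h) := fun κ =>
    (measurable_gap_policy hμ hγ v κ A n).comp (measurable_prodMk_left (x := u))
  -- The gaps a, b satisfy a + b ≥ D but either may vanish. Adding D/8 to each bounds their product
  -- below: (a + D/8)(b + D/8) ≥ D²/8.
  have key := history_affinity hμ hγ hv κ κ' A u n (c := ENNReal.ofReal (D / 8 * D))
    (f := fun h => ENNReal.ofReal (gap μ γ v κ (A.policy n u h) + D / 8))
    (g := fun h => ENNReal.ofReal (gap μ γ v κ' (A.policy n u h) + D / 8))
    ((hm κ).add_const _).ennreal_ofReal ((hm κ').add_const _).ennreal_ofReal fun h => by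
      have ha := hg0 h1 h
      have hb := hg0 h1' h
      rw [← ENNReal.ofReal_mul (by positivity)]
      refine ENNReal.ofReal_le_ofReal ?_
      have := le_gap_add_gap hμ hγ v h1 h1' (measurable_policy A n u h)
      rw [← hp, ← hD] at this
      nlinarith [mul_nonneg ha hb]
  have key2 := (mul_le_mul_right (half_le_recordAffinity_pow hμ hγ hv _ n hn)
    (ENNReal.ofReal (D / 8 * D))).trans key
  have hadd : ∀ {κ : ℝ≥0}, κ ≤ 1 →
      ∫⁻ ω, ENNReal.ofReal (gap μ γ v κ (A.policy n u (A.history (uniformEnv v κ) u ω n)) + D / 8)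
        ∂(Measure.infinitePi fun _ : ℕ => uniformEpisodeLaw μ γ v)
      = (∫⁻ ω, ENNReal.ofReal (gap μ γ v κ (A.played (uniformEnv v κ) u ω n))
        ∂(Measure.infinitePi fun _ : ℕ => uniformEpisodeLaw μ γ v)) + ENNReal.ofReal (D / 8) :=
    fun {κ} h1 => by
      simp_rw [ENNReal.ofReal_add (hg0 h1 _) (show 0 ≤ D / 8 by positivity)]
      rw [lintegral_add_right _ measurable_const]
      simp [Algorithm.played]
  rw [hadd h1, hadd h1', ← ENNReal.ofReal_mul (by positivity)] at key2
  set x := ∫⁻ ω, ENNReal.ofReal (gap μ γ v κ (A.played (uniformEnv v κ) u ω n))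
        ∂(Measure.infinitePi fun _ : ℕ => uniformEpisodeLaw μ γ v)
  set y := ∫⁻ ω, ENNReal.ofReal (gap μ γ v κ' (A.played (uniformEnv v κ') u ω n))
        ∂(Measure.infinitePi fun _ : ℕ => uniformEpisodeLaw μ γ v)
  by_cases hx : x = ∞
  · simp [hx]
  by_cases hy : y = ∞
  · simp [hy]
  rw [← ENNReal.ofReal_toReal hx, ← ENNReal.ofReal_toReal hy] at key2 ⊢
  have hX : 0 ≤ x.toReal := ENNReal.toReal_nonneg
  have hY : 0 ≤ y.toReal := ENNReal.toReal_nonneg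
  rw [← ENNReal.ofReal_add hX (by positivity), ← ENNReal.ofReal_add hY (by positivity),
    ← ENNReal.ofReal_mul (by positivity), ENNReal.ofReal_le_ofReal_iff (by positivity)] at key2
  rw [← ENNReal.ofReal_add hX hY]
  refine ENNReal.ofReal_le_ofReal ?_
  -- If the expected gaps summed to less than D/4, then by AM–GM the product of the two shifted
  -- expectations would be below D²/16.
  by_contra hcon
  rw [not_le] at hcon
  nlinarith [sq_nonneg (x.toReal - y.toReal)]

theorem integrable_gap_played (hμ : 0 < μ) (hγ : 0 < γ) (v : ℝ≥0) {κ : ℝ≥0} (h1 : κ ≤ 1)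
    (A : Algorithm Seed) (ρ : Measure Seed) [IsProbabilityMeasure ρ] (n : ℕ) :
    Integrable (fun x : Seed × (ℕ → Sample) =>
      gap μ γ v κ (A.played (uniformEnv v κ) x.1 x.2 n))
      (ρ.prod (Measure.infinitePi fun _ : ℕ => uniformEpisodeLaw μ γ v)) := by
  have := isProbabilityMeasure_uniformEpisodeLaw hμ hγ v
  refine (integrable_const (∑' i : ℕ, (uniformEpisodeLaw μ γ v).real {s | i < s.numAuctions})).mono'
    (measurable_gap_played hμ hγ v κ A n).aestronglyMeasurable
    (Filter.Eventually.of_forall fun x => ?_)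
  have hm : Measurable (A.played (uniformEnv v κ) x.1 x.2 n) := measurable_policy A n _ _
  rw [Real.norm_of_nonneg (gap_nonneg hμ hγ v h1 hm)]
  exact gap_le hμ hγ v h1 hm

/-- The expected regret of episode `n`. -/
noncomputable def episodeRegret (A : Algorithm Seed) (ρ : Measure Seed) (μ γ : ℝ) (v κ : ℝ≥0)
    (n : ℕ) : ℝ :=
  ∫ x, gap μ γ v κ (A.played (uniformEnv v κ) x.1 x.2 n)
    ∂(ρ.prod (Measure.infinitePi fun _ : ℕ => uniformEpisodeLaw μ γ v))

theorem expectedRegret_uniformEnv (hμ : 0 < μ) (hγ : 0 < γ) (v : ℝ≥0) {κ : ℝ≥0} (h1 : κ ≤ 1)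
    (A : Algorithm Seed) (ρ : Measure Seed) [IsProbabilityMeasure ρ] (N : ℕ) :
    A.expectedRegret ρ μ γ (uniformEnv v κ) N
      = ∑ n ∈ Finset.range N, episodeRegret A ρ μ γ v κ n := by
  simp only [Algorithm.expectedRegret, Algorithm.regret, episodeLaw_uniformEnv]
  exact integral_finsetSum _ fun n _ => integrable_gap_played hμ hγ v h1 A ρ n

theorem episodeRegret_nonneg (hμ : 0 < μ) (hγ : 0 < γ) (v : ℝ≥0) {κ : ℝ≥0} (h1 : κ ≤ 1)
    (A : Algorithm Seed) (ρ : Measure Seed) (n : ℕ) : 0 ≤ episodeRegret A ρ μ γ v κ n :=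
  integral_nonneg fun _ => gap_nonneg hμ hγ v h1 (measurable_policy A n _ _)

theorem ofReal_episodeRegret (hμ : 0 < μ) (hγ : 0 < γ) (v : ℝ≥0) {κ : ℝ≥0} (h1 : κ ≤ 1)
    (A : Algorithm Seed) (ρ : Measure Seed) [IsProbabilityMeasure ρ] (n : ℕ) :
    ENNReal.ofReal (episodeRegret A ρ μ γ v κ n)
      = ∫⁻ u, ∫⁻ ω, ENNReal.ofReal (gap μ γ v κ (A.played (uniformEnv v κ) u ω n))
        ∂(Measure.infinitePi fun _ : ℕ => uniformEpisodeLaw μ γ v) ∂ρ := by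
  have := isProbabilityMeasure_uniformEpisodeLaw hμ hγ v
  rw [episodeRegret, ofReal_integral_eq_lintegral_ofReal (integrable_gap_played hμ hγ v h1 A ρ n)
    (Filter.Eventually.of_forall fun _ => gap_nonneg hμ hγ v h1 (measurable_policy A n _ _)),
    lintegral_prod _ (measurable_gap_played hμ hγ v κ A n).ennreal_ofReal.aemeasurable]

theorem le_episodeRegret_add (hμ : 0 < μ) (hγ : 0 < γ) {v : ℝ≥0} (hv : v ≠ 0) {κ κ' : ℝ≥0}
    (h1 : κ ≤ 1) (h1' : κ' ≤ 1) (A : Algorithm Seed) (ρ : Measure Seed) [IsProbabilityMeasure ρ]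
    (n : ℕ) (hn : n * (((κ' : ℝ) - κ) ^ 2 * (∫⁻ s, (s.numAuctions : ℝ≥0∞) ^ 2
      ∂(uniformEpisodeLaw μ γ v)).toReal) ≤ 2 * v) :
    (uniformEpisodeLaw μ γ v).real {s | 0 < s.numAuctions} * (((κ' : ℝ) - κ) ^ 2 / 16)
      ≤ episodeRegret A ρ μ γ v κ n + episodeRegret A ρ μ γ v κ' n := by
  have := isProbabilityMeasure_uniformEpisodeLaw hμ hγ v
  have ha := episodeRegret_nonneg hμ hγ v h1 A ρ n
  have hb := episodeRegret_nonneg hμ hγ v h1' A ρ n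
  rw [← ENNReal.ofReal_le_ofReal_iff (add_nonneg ha hb), ENNReal.ofReal_add ha hb,
    ofReal_episodeRegret hμ hγ v h1, ofReal_episodeRegret hμ hγ v h1',
    ← lintegral_add_left (measurable_gap_played hμ hγ v κ A n).ennreal_ofReal.lintegral_prod_right']
  calc _ = ∫⁻ _, ENNReal.ofReal ((uniformEpisodeLaw μ γ v).real {s | 0 < s.numAuctions} *
        (((κ' : ℝ) - κ) ^ 2 / 16)) ∂ρ := by simp
    _ ≤ _ := lintegral_mono fun u => le_lintegral_gap_add hμ hγ hv h1 h1' A u n hn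

/-- Each index occurs in at most two pairs (j, d + j). -/
theorem sum_range_add_shift_le {f : ℕ → ℝ} {d k : ℕ} (hf : ∀ j < d + k, 0 ≤ f j) :
    ∑ j ∈ Finset.range k, (f j + f (d + j)) ≤ 2 * ∑ j ∈ Finset.range (d + k), f j := by
  have h1 : ∑ j ∈ Finset.range k, f j ≤ ∑ j ∈ Finset.range (d + k), f j :=
    Finset.sum_le_sum_of_subset_of_nonneg (Finset.range_mono (by omega))
      fun j hj _ => hf j (Finset.mem_range.1 hj)
  have h2 : ∑ j ∈ Finset.range k, f (d + j) ≤ ∑ j ∈ Finset.range (d + k), f j := by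
    rw [Finset.sum_range_add]
    exact le_add_of_nonneg_left (Finset.sum_nonneg fun j hj =>
      hf j (by have := Finset.mem_range.1 hj; omega))
  rw [Finset.sum_add_distrib]
  linarith

/-- The sum of the regrets of episode `n` over a fine grid of mean rewards. -/
theorem le_sum_episodeRegret (hμ : 0 < μ) (hγ : 0 < γ) {v : ℝ≥0} (hv : v ≠ 0)
    (A : Algorithm Seed) (ρ : Measure Seed) [IsProbabilityMeasure ρ] {s : ℝ} (hs0 : 0 < s)
    (hs1 : s ≤ 1 / 2) (hs2 : s ^ 2 * (∫⁻ s, (s.numAuctions : ℝ≥0∞) ^ 2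
      ∂(uniformEpisodeLaw μ γ v)).toReal ≤ 2 * v) {J n : ℕ} (hJ : (n + 1 : ℝ) ≤ J * s) :
    J * ((uniformEpisodeLaw μ γ v).real {s | 0 < s.numAuctions} * s ^ 2 / 256 / (n + 1))
      ≤ ∑ j ∈ Finset.range J, episodeRegret A ρ μ γ v (j / J) n := by
  set p := (uniformEpisodeLaw μ γ v).real {s | 0 < s.numAuctions}
  have hp0 : 0 ≤ p := measureReal_nonneg
  set M := (∫⁻ s, (s.numAuctions : ℝ≥0∞) ^ 2 ∂(uniformEpisodeLaw μ γ v)).toReal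
  have hM : 0 ≤ M := ENNReal.toReal_nonneg
  have hn1 : (0 : ℝ) < n + 1 := by positivity
  have hJs : 0 < (J : ℝ) * s := hn1.trans_le hJ
  have hJ0 : (0 : ℝ) < J := by
    by_contra h
    nlinarith
  set q := √((n : ℝ) + 1) with hq
  have hq2 : q ^ 2 = n + 1 := Real.sq_sqrt hn1.le
  have hq0 : 0 < q := Real.sqrt_pos.2 hn1
  have hq1 : 1 ≤ q := Real.one_le_sqrt.2 (by linarith [(Nat.cast_nonneg n : (0 : ℝ) ≤ n)])
  -- The ideal spacing s/√(n+1) measured in grid steps. It is at least 1 because √(n+1) ≤ n + 1 ≤ J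
  -- s, and at most J/2 because s ≤ 1/2. Rounding down costs at most a factor 2.
  set x := J * s / q with hx
  have hxq : x * q = J * s := by rw [hx]; field_simp
  have hx1 : 1 ≤ x := by rw [hx, le_div_iff₀ hq0]; nlinarith
  have hxJ : x ≤ J / 2 := by nlinarith
  set d := ⌊x⌋₊ with hd
  have hdx : (d : ℝ) ≤ x := Nat.floor_le (by linarith)
  have hdx2 : x / 2 ≤ d := by
    have h1 := Nat.lt_floor_add_one x
    have h2 : (1 : ℝ) ≤ d := by exact_mod_cast Nat.one_le_floor_iff _ |>.2 hx1
    rw [← hd] at h1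
    linarith
  obtain ⟨k, hk⟩ : ∃ k, J = d + k := Nat.exists_eq_add_of_le (by
    have : (d : ℝ) ≤ J := by linarith
    exact_mod_cast this)
  have hkJ : (J : ℝ) / 2 ≤ k := by
    have : (J : ℝ) = d + k := by exact_mod_cast hk
    linarith
  have hle : ∀ j < J, ((j : ℝ≥0) / J) ≤ 1 := fun j hj => by
    refine div_le_one_of_le₀ ?_ zero_le
    exact_mod_cast hj.le
  have hpair : ∀ j ∈ Finset.range k, p * s ^ 2 / 64 / (n + 1)
      ≤ episodeRegret A ρ μ γ v ((j : ℕ) / J) n + episodeRegret A ρ μ γ v ((d + j : ℕ) / J) n := by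
    intro j hj
    have hj' := Finset.mem_range.1 hj
    have hδ : ((((d + j : ℕ) : ℝ≥0) / J : ℝ≥0) : ℝ) - ((j : ℝ≥0) / J : ℝ≥0) = d / J := by
      push_cast; ring
    have hδ1 : (d / J : ℝ) ≤ s / q := by
      rw [div_le_div_iff₀ hJ0 hq0]
      nlinarith
    have hδ2 : s / q / 2 ≤ (d / J : ℝ) := by
      rw [div_div, div_le_div_iff₀ (by positivity) hJ0]
      nlinarith
    refine le_trans ?_ (le_episodeRegret_add hμ hγ hv (hle j (by omega)) (hle (d + j) (by omega))
      A ρ n ?_)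
    · rw [hδ]
      have h3 : (s / q / 2) ^ 2 ≤ (d / J : ℝ) ^ 2 := by gcongr
      have h4 : p * s ^ 2 / 64 / (n + 1) = p * ((s / q / 2) ^ 2 / 16) := by
        rw [div_pow, div_pow, hq2]; ring
      rw [h4]
      gcongr
    · rw [hδ]
      have h3 : (d / J : ℝ) ^ 2 ≤ (s / q) ^ 2 := by gcongr
      rw [div_pow s q, hq2] at h3
      calc (n : ℝ) * ((d / J : ℝ) ^ 2 * M) ≤ n * (s ^ 2 / (n + 1) * M) := by gcongr
        _ = n / (n + 1) * (s ^ 2 * M) := by ring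
        _ ≤ 1 * (s ^ 2 * M) := by
          gcongr
          rw [div_le_one hn1]; linarith
        _ ≤ 2 * v := by rw [one_mul]; exact hs2
  -- The constant 256 is 64 · 2 · 2: at least J/2 pairs contribute, and each grid point is counted
  -- at most twice.
  have hsum := sum_range_add_shift_le (f := fun j : ℕ => episodeRegret A ρ μ γ v (j / J) n)
    (d := d) (k := k) fun j hj => episodeRegret_nonneg hμ hγ v (hle j (by omega)) A ρ n
  rw [← hk] at hsum
  have hcard := Finset.card_nsmul_le_sum _ _ _ hpair
  rw [Finset.card_range, nsmul_eq_mul] at hcard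
  have hc0 : 0 ≤ p * s ^ 2 / 64 / (n + 1) := by positivity
  have h5 : (J : ℝ) / 2 * (p * s ^ 2 / 64 / (n + 1)) ≤ k * (p * s ^ 2 / 64 / (n + 1)) := by gcongr
  have h6 : J * (p * s ^ 2 / 256 / (n + 1)) = (J : ℝ) / 2 * (p * s ^ 2 / 64 / (n + 1)) / 2 := by
    ring
  rw [h6]
  linarith

theorem log_le_sum_inv (N : ℕ) : Real.log N ≤ ∑ n ∈ Finset.range N, 1 / ((n : ℝ) + 1) := by
  rcases Nat.eq_zero_or_pos N with rfl | hN
  · simp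
  have h := log_add_one_le_harmonic N
  rw [harmonic] at h
  push_cast at h
  refine (Real.log_le_log (by exact_mod_cast hN) (by linarith)).trans (h.trans (le_of_eq ?_))
  exact Finset.sum_congr rfl fun n _ => by rw [one_div]

end LowerBound

end DynamicBidding

/-! ### Choice of the constants and of the bad environment. -/

theorem mainTheorem3
    (μ γ : ℝ) (hμ : 0 < μ) (hγ : 0 < γ)
    (σsq : ℝ≥0) (hσ : 0 < σsq)
    (α : ℝ) (hα₀ : 0 < α) (hα₁ : α < 1)
    (mk mq : ℕ)
    (t : Fin (mk + 1) → ℝ) (ht : StrictMono t) (ht₀ : t 0 = 0)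
    (b : Fin (mq + 1) → ℝ) (hb : StrictMono b) (hb₀ : b 0 = 0) (hb₁ : b (Fin.last mq) = 1) :
    ∃ C : ℝ, 0 < C ∧
      ∀ (Seed : Type) [MeasurableSpace Seed] (ρ : Measure Seed) [IsProbabilityMeasure ρ]
        (A : DynamicBidding.Algorithm Seed) (N : ℕ), 1 ≤ N →
        ∃ E : DynamicBidding.Environment,
          E.IsAdmissible t b α σsq ∧
          C * Real.log N ≤ A.expectedRegret ρ μ γ E N := by
  open DynamicBidding in
  have := isProbabilityMeasure_uniformEpisodeLaw hμ hγ σsq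
  have hv : (0 : ℝ) < σsq := by exact_mod_cast hσ
  set M := (∫⁻ s, (s.numAuctions : ENNReal) ^ 2 ∂(uniformEpisodeLaw μ γ σsq)).toReal with hM
  have hM0 : 0 ≤ M := ENNReal.toReal_nonneg
  set p := (uniformEpisodeLaw μ γ σsq).real {s | 0 < s.numAuctions} with hp
  have hp0 : 0 < p :=
    ENNReal.toReal_pos (measure_zero_lt_numAuctions_pos hμ hγ σsq).ne' (measure_ne_top _ _)
  -- The scale `s` leaves room for the shift on the grid and keeps paired means indistinguishable;
  -- `M + 1` avoids dividing by zero.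
  obtain ⟨s, hs0, hs1, hs2⟩ : ∃ s : ℝ, 0 < s ∧ s ≤ 1 / 2 ∧ s ^ 2 * M ≤ 2 * σsq := by
    refine ⟨min (1 / 2) √(2 * σsq / (M + 1)), lt_min (by norm_num) (by positivity),
      min_le_left _ _, ?_⟩
    calc (min (1 / 2) √(2 * σsq / (M + 1))) ^ 2 * M
        ≤ √(2 * σsq / (M + 1)) ^ 2 * M := by
          gcongr
          exact min_le_right _ _
      _ = 2 * σsq * (M / (M + 1)) := by rw [Real.sq_sqrt (by positivity)]; ring
      _ ≤ 2 * σsq * 1 := by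
          gcongr
          rw [div_le_one (by positivity)]; linarith
      _ = 2 * σsq := mul_one _
  refine ⟨p * s ^ 2 / 256, by positivity, ?_⟩
  intro Seed _ ρ _ A N hN
  -- The grid may depend on the horizon, since `C` does not involve `J`. This mesh is fine enough
  -- for every episode `n < N`.
  obtain ⟨J, hJ⟩ := exists_nat_ge ((N : ℝ) / s)
  rw [div_le_iff₀ hs0] at hJ
  have hN0 : (0 : ℝ) < N := by exact_mod_cast hN
  have hJ0 : 0 < J := by
    rcases Nat.eq_zero_or_pos J with rfl | h
    · simp only [Nat.cast_zero, zero_mul] at hJ; linarith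
    · exact h
  have hle : ∀ j ∈ Finset.range J, ((j : ℝ≥0) / J) ≤ 1 := fun j hj => by
    refine div_le_one_of_le₀ ?_ zero_le
    exact_mod_cast (Finset.mem_range.1 hj).le
  -- All episodes share the same uniform average over the grid, so the sums over `j` and `n` can be
  -- exchanged and each episode bounded with its own pairing.
  have hsum : ∑ _j ∈ Finset.range J, p * s ^ 2 / 256 * Real.log N
      ≤ ∑ j ∈ Finset.range J, A.expectedRegret ρ μ γ
        (uniformEnv σsq ((j : ℝ≥0) / J : ℝ≥0)) N := by
    rw [Finset.sum_congr rfl fun j hj =>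
      expectedRegret_uniformEnv hμ hγ σsq (hle j hj) A ρ N, Finset.sum_comm, Finset.sum_const,
      Finset.card_range, nsmul_eq_mul]
    calc (J : ℝ) * (p * s ^ 2 / 256 * Real.log N)
        ≤ J * (p * s ^ 2 / 256 * ∑ n ∈ Finset.range N, 1 / ((n : ℝ) + 1)) := by
          gcongr
          exact log_le_sum_inv N
      _ = ∑ n ∈ Finset.range N, J * (p * s ^ 2 / 256 / (n + 1)) := by
          rw [Finset.mul_sum, Finset.mul_sum]
          exact Finset.sum_congr rfl fun n _ => by ring
      _ ≤ _ := Finset.sum_le_sum fun n hn => by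
          refine le_sum_episodeRegret hμ hγ hσ.ne' A ρ hs0 hs1 hs2 (le_trans ?_ hJ)
          exact_mod_cast Finset.mem_range.1 hn
  obtain ⟨j, hj, hreg⟩ := Finset.exists_le_of_sum_le
    (Finset.nonempty_range_iff.2 hJ0.ne') hsum
  exact ⟨_, isAdmissible_uniformEnv t b hb₀ hb₁ hα₁ σsq (NNReal.coe_nonneg _)
    (by exact_mod_cast hle j hj), hreg⟩
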